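/- **Setting.** Let $m\ge 1$, let $w=(w_1,\dots,w_m)$ be nonzero real polynomials in $n$ variables, and let $d=(d_1,\dots,d_m)$ be nonnegative integers. Assume that $S_w=\{x\in\mathbb R^n: w_i(x)\ge 0,\ i=1,\dots,m\}$ is bounded. Let $\mathcal V$ be the space of all polynomials $\sum_i w_i r_i$ with $\deg r_i\le 2d_i$, put $U=\dim\mathcal V$, and let a polynomial be called WSOS if it is of the form $\sum_i w_i\sigma_i$, where each $\sigma_i$ is a sum of squares of polynomials of degree at most $d_i$. Let $\{z_1,\dots,z_U\}\subseteq S_w$ be unisolvent for $\mathcal V$ (elements of $\mathcal V$ are determined by their values at these points), and let $q=(q_1,\dots,q_U)$ be the corresponding Lagrange basis of $\mathcal V$, i.e. $q_i(z_j)=\delta_{ij}$. Identify polynomials in $\mathcal V$ with their coefficient vectors in the basis $q$. Let $\Sigma\subseteq\mathbb R^U$ be the cone of the WSOS polynomials and $\Sigma^*=\{y\in\mathbb R^U: s^{\mathrm T}y\ge 0\ \forall s\in\Sigma\}$ its dual cone; $\circ$ and $\mathrm{bd}$ denote interior and boundary in $\mathbb R^U$. For each $i$ fix a basis $p_i=(p_{i,1},\dots,p_{i,L_i})$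 of the space of polynomials of degree at most $d_i$. Let $\Lambda_i$ be the linear map from $\mathbb R^U$ to the symmetric $L_i\times L_i$ matrices with $\Lambda_i(q)=w_i\,p_ip_i^{\mathrm T}$: its $(j,k)$ entry at $v$ is $\sum_l c_lv_l$, where $w_ip_{i,j}p_{i,k}=\sum_l c_lq_l$. Put $\Lambda=\Lambda_1\oplus\dots\oplus\Lambda_m$, $\nu=\sum_i L_i$, and let $H(x)$ be the Hessian at $x\in(\Sigma^*)^\circ$ of $f(x)=-\ln\det\Lambda(x)$. A vector $x\in(\Sigma^*)^\circ$ is a (dual) certificate of $t\in\Sigma$ if $H(x)^{-1}t\in\Sigma^*$. For $e\in\mathbb R^U$ put $k_1^{e}=\min\{e^{\mathrm T}v: v\in\Sigma^*,\ \|v\|_\infty=1\}$. **Theorem.** Suppose that $\mu>0$ satisfies $\mu+q_i\in\Sigma$ and $\mu-q_i\in\Sigma$ for all $i=1,\dots,U$. Then the constant polynomial $1$ lies in $\mathcal V$, its coefficient vector $\mathbf 1$ is the all-ones vector, and the following hold. 1. The minimum defining $k_1^{\mathbf 1}$ exists, and $k_1^{\mathbf 1}\ge \frac1\mu$. 2.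 Among the matrices $\mathbf M=\sum_{i=1}^s\alpha_i\,q(\zeta_i)q(\zeta_i)^{\mathrm T}$, where $\{\zeta_1,\dots,\zeta_s\}\subseteq S_w$ ($s\ge U$) is unisolvent for $\mathcal V$ and $\alpha_1,\dots,\alpha_s>0$, is the identity matrix $\mathbf I$, whose condition number $\lambda_{\max}/\lambda_{\min}$ is $1$. 3. For all $t\in\Sigma^\circ$ and $\varepsilon>0$ with $t-\varepsilon\mathbf 1\in\mathrm{bd}(\Sigma)$, there is an integer vector $\bar y\in(\Sigma^*)^\circ\cap\mathbb Z^U$ that is a certificate of $t$ and satisfies both $$\|\bar y\|_\infty\le\frac12+\Big\lceil\tfrac32\sqrt U\,\|t\|_2\Big\rceil\frac{\mu\nu}{\varepsilon}$$ and $$\log\|\bar y\|_\infty\le C\big(\log U+\log\|t\|_2+\log\mu+\log\nu+\log(1/\varepsilon)\big),$$ where $C>0$ is an absolute constant (independent of all the data above). -/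

import Mathlib

open MvPolynomial

namespace WSOS

noncomputable section

/-- The space of real `n`-variate polynomials of degree at most `k`. -/
abbrev polyDeg (n k : ℕ) : Submodule ℝ (MvPolynomial (Fin n) ℝ) :=
  restrictTotalDegree (Fin n) ℝ k

/-- The cone of sums of squares of polynomials of degree at most `k`. -/
def sosCone (n k : ℕ) : Set (MvPolynomial (Fin n) ℝ) :=
  {p | ∃ (r : ℕ) (g : Fin r → MvPolynomial (Fin n) ℝ),
    (∀ j, g j ∈ polyDeg n k) ∧ p = ∑ j, g j ^ 2}

/-- The space of polynomials `∑ i, w i * r i` with `r i` of degree at most `2 * d i`. -/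
def wSpace {n m : ℕ} (w : Fin m → MvPolynomial (Fin n) ℝ) (d : Fin m → ℕ) :
    Submodule ℝ (MvPolynomial (Fin n) ℝ) where
  carrier := {p | ∃ r : Fin m → MvPolynomial (Fin n) ℝ,
    (∀ i, r i ∈ polyDeg n (2 * d i)) ∧ p = ∑ i, w i * r i}
  add_mem' := by
    rintro _ _ ⟨r, hr, rfl⟩ ⟨s, hs, rfl⟩
    exact ⟨r + s, fun i => Submodule.add_mem _ (hr i) (hs i), by
      simp [mul_add, Finset.sum_add_distrib]⟩
  zero_mem' := ⟨0, fun _ => Submodule.zero_mem _, by simp⟩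
  smul_mem' := by
    rintro c _ ⟨r, hr, rfl⟩
    exact ⟨c • r, fun i => Submodule.smul_mem _ c (hr i), by
      simp [Finset.smul_sum]⟩

/-- The set of weighted sums of squares `∑ i, w i * σ i`, where `σ i` is a sum of squares
of polynomials of degree at most `d i`. -/
def wsosPolys {n m : ℕ} (w : Fin m → MvPolynomial (Fin n) ℝ) (d : Fin m → ℕ) :
    Set (MvPolynomial (Fin n) ℝ) :=
  {p | ∃ σ : Fin m → MvPolynomial (Fin n) ℝ,
    (∀ i, σ i ∈ sosCone n (d i)) ∧ p = ∑ i, w i * σ i}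

/-- The basic closed semialgebraic set on which all the weights are nonnegative. -/
def semialgSet {n m : ℕ} (w : Fin m → MvPolynomial (Fin n) ℝ) : Set (Fin n → ℝ) :=
  {x | ∀ i, 0 ≤ eval x (w i)}

/-- `S` is unisolvent for `V`: elements of `V` are determined by their values on `S`. -/
def IsUnisolvent {n : ℕ} (V : Submodule ℝ (MvPolynomial (Fin n) ℝ)) (S : Set (Fin n → ℝ)) :
    Prop :=
  ∀ p ∈ V, ∀ p' ∈ V, (∀ x ∈ S, eval x p = eval x p') → p = p'

/-- The polynomial with coefficient vector `s` in the basis `q`. -/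
def toPoly {n U : ℕ} {V : Submodule ℝ (MvPolynomial (Fin n) ℝ)}
    (q : Module.Basis (Fin U) ℝ V) (s : Fin U → ℝ) : MvPolynomial (Fin n) ℝ :=
  ∑ l, s l • (q l : MvPolynomial (Fin n) ℝ)

/-- The cone `Σ ⊆ ℝ^U` of the coefficient vectors of the WSOS polynomials. -/
def cone {n m U : ℕ} (w : Fin m → MvPolynomial (Fin n) ℝ) (d : Fin m → ℕ)
    (q : Module.Basis (Fin U) ℝ (wSpace w d)) : Set (Fin U → ℝ) :=
  {s | toPoly q s ∈ wsosPolys w d}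

/-- The dual cone with respect to the standard inner product. -/
def dualCone {U : ℕ} (K : Set (Fin U → ℝ)) : Set (Fin U → ℝ) :=
  {y | ∀ x ∈ K, 0 ≤ x ⬝ᵥ y}

theorem mul_mul_mem_wSpace {n m : ℕ} (w : Fin m → MvPolynomial (Fin n) ℝ) (d : Fin m → ℕ)
    (i : Fin m) {a b : MvPolynomial (Fin n) ℝ} (ha : a ∈ polyDeg n (d i))
    (hb : b ∈ polyDeg n (d i)) : w i * (a * b) ∈ wSpace w d := by
  refine ⟨Pi.single i (a * b), fun j => ?_, ?_⟩
  · rcases eq_or_ne j i with rfl | h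
    · rw [Pi.single_eq_same, mem_restrictTotalDegree]
      rw [mem_restrictTotalDegree] at ha hb
      have := totalDegree_mul a b
      omega
    · rw [Pi.single_eq_of_ne h]
      exact Submodule.zero_mem _
  · rw [Finset.sum_eq_single i]
    · simp
    · intro j _ h
      simp [Pi.single_eq_of_ne h]
    · simp

/-- The linear map `Λ_i`: the `(j, k)` entry of `Λ_i(v)` is the linear combination of the
components of `v` that yields `w_i p_{ij} p_{ik}` when applied to the basis polynomials `q`. -/
def lam {n m U : ℕ} (w : Fin m → MvPolynomial (Fin n) ℝ) (d : Fin m → ℕ)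
    (q : Module.Basis (Fin U) ℝ (wSpace w d)) {L : Fin m → ℕ}
    (p : (i : Fin m) → Module.Basis (Fin (L i)) ℝ (polyDeg n (d i)))
    (i : Fin m) (v : Fin U → ℝ) : Matrix (Fin (L i)) (Fin (L i)) ℝ :=
  Matrix.of fun j k => ∑ l, q.repr
    ⟨w i * (((p i j : polyDeg n (d i)) : MvPolynomial (Fin n) ℝ) *
        ((p i k : polyDeg n (d i)) : MvPolynomial (Fin n) ℝ)),
      mul_mul_mem_wSpace w d i (p i j).2 (p i k).2⟩ l * v l

/-- The block diagonal operator `Λ = Λ_1 ⊕ ⋯ ⊕ Λ_m`. -/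
def lamBlock {n m U : ℕ} (w : Fin m → MvPolynomial (Fin n) ℝ) (d : Fin m → ℕ)
    (q : Module.Basis (Fin U) ℝ (wSpace w d)) {L : Fin m → ℕ}
    (p : (i : Fin m) → Module.Basis (Fin (L i)) ℝ (polyDeg n (d i))) (v : Fin U → ℝ) :
    Matrix ((i : Fin m) × Fin (L i)) ((i : Fin m) × Fin (L i)) ℝ :=
  Matrix.blockDiagonal' fun i => lam w d q p i v

/-- The barrier function `x ↦ - ln det Λ(x)` (used on the interior of the dual cone only). -/
def barrier {n m U : ℕ} (w : Fin m → MvPolynomial (Fin n) ℝ) (d : Fin m → ℕ)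
    (q : Module.Basis (Fin U) ℝ (wSpace w d)) {L : Fin m → ℕ}
    (p : (i : Fin m) → Module.Basis (Fin (L i)) ℝ (polyDeg n (d i))) (x : Fin U → ℝ) : ℝ :=
  -Real.log (lamBlock w d q p x).det

/-- The Hessian matrix of a function on `ℝ^U`. -/
def hessian {U : ℕ} (f : (Fin U → ℝ) → ℝ) (x : Fin U → ℝ) : Matrix (Fin U) (Fin U) ℝ :=
  Matrix.of fun a b => fderiv ℝ (fderiv ℝ f) x (Pi.single a 1) (Pi.single b 1)

/-- `x` is a dual certificate of `s`: `s ∈ Σ`, `x ∈ (Σ^*)°` and `H(x)⁻¹ s ∈ Σ^*`, where `H` is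
the Hessian of the barrier function. -/
def IsDualCertificate {n m U : ℕ} (w : Fin m → MvPolynomial (Fin n) ℝ) (d : Fin m → ℕ)
    (q : Module.Basis (Fin U) ℝ (wSpace w d)) {L : Fin m → ℕ}
    (p : (i : Fin m) → Module.Basis (Fin (L i)) ℝ (polyDeg n (d i))) (s x : Fin U → ℝ) : Prop :=
  s ∈ cone w d q ∧ x ∈ interior (dualCone (cone w d q)) ∧
    Matrix.mulVec (hessian (barrier w d q p) x)⁻¹ s ∈ dualCone (cone w d q)

/-- The values `eᵀ v` for `v` in the dual cone with `‖v‖_∞ = 1`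
(the norm of `Fin U → ℝ` is the maximum norm). -/
def kOneSet {U : ℕ} (K : Set (Fin U → ℝ)) (e : Fin U → ℝ) : Set ℝ :=
  {c | ∃ v ∈ dualCone K, ‖v‖ = 1 ∧ c = e ⬝ᵥ v}

/-- The constant `k_1^e`, the minimum of `eᵀ v` over `v` in the dual cone with `‖v‖_∞ = 1`. -/
def kOne {U : ℕ} (K : Set (Fin U → ℝ)) (e : Fin U → ℝ) : ℝ :=
  sInf (kOneSet K e)

/-- The vector `q(x)` of the values at `x` of the basis polynomials. -/
def evalBasis {n U : ℕ} {V : Submodule ℝ (MvPolynomial (Fin n) ℝ)}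
    (q : Module.Basis (Fin U) ℝ V) (x : Fin n → ℝ) : Fin U → ℝ :=
  fun l => eval x (q l : MvPolynomial (Fin n) ℝ)

/-- `M = ∑ i, α_i q(z_i) q(z_i)ᵀ` for some positive `α_i` and some unisolvent set
`{z_1, …, z_s}` of points at which all the weights are nonnegative. -/
def IsNodeMatrix {n m U : ℕ} (w : Fin m → MvPolynomial (Fin n) ℝ) (d : Fin m → ℕ)
    (q : Module.Basis (Fin U) ℝ (wSpace w d)) (M : Matrix (Fin U) (Fin U) ℝ) : Prop :=
  ∃ (s : ℕ) (z : Fin s → Fin n → ℝ) (α : Fin s → ℝ),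
    U ≤ s ∧ Function.Injective z ∧ (∀ i, z i ∈ semialgSet w) ∧
    IsUnisolvent (wSpace w d) (Set.range z) ∧ (∀ i, 0 < α i) ∧
    M = ∑ i, α i • Matrix.vecMulVec (evalBasis q (z i)) (evalBasis q (z i))

/-- The condition number `λ_max / λ_min` of a symmetric positive definite matrix. -/
def cond {U : ℕ} (M : Matrix (Fin U) (Fin U) ℝ) : ℝ :=
  sSup (spectrum ℝ M) / sInf (spectrum ℝ M)

/-- The Euclidean norm on `ℝ^U`. -/
def norm2 {U : ℕ} (t : Fin U → ℝ) : ℝ :=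
  ‖WithLp.toLp 2 t‖

/-- The all-ones vector. -/
def ones (U : ℕ) : Fin U → ℝ := fun _ => 1

end

end WSOS

/-! The assumption $\mu\pm q_i\in\Sigma$ says that $|v_i|\le\mu\,\mathbf 1^Tv$ on $\Sigma^*$
(`abs_apply_le_of_mem_dualCone`); this gives $k_1^{\mathbf 1}\ge 1/\mu$ at once. Since $q(z_a)$ is
the unit vector $e_a$, unit weights at the nodes give $\mathbf M=\mathbf I$.

For integer certificates, $\Sigma^*$ is the set where $\Lambda$ is positive semidefinite
(`mem_dualCone_iff`). Maximizing $\det\Lambda$ on a slice $t^Tv=\nu$ yields $x$ with $t=-\nabla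
f(x)$ (`exists_gradient_eq`). Then $t^Tx=\nu$, and $t-\varepsilon\mathbf 1\in\overline\Sigma$ gives
$\mathbf 1^Tx\le\nu/\varepsilon$, hence $\|x\|_\infty\le\mu\nu/\varepsilon$
(`exists_gradientCertificate`).

Every $y$ in the open unit Dikin ellipsoid at $x$ certifies $t$
(`posSemidef_gramMatrix_inv_mulVec`): with $X=\Lambda(x)$ and $Y=\Lambda(y)$, the matrix
$\Lambda(H(y)^{-1}t)$ is the projection of $YX^{-1}Y$ onto the range of $\Lambda$, in the local
inner product at $Y$. It is thus no farther from $Y$ than $YX^{-1}Y$, whose distance to $Y$ equals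
that of $Y$ from $X$ measured at $X$.

As $e_a\in\Sigma^*$, the local norm at $x$ is at most $\sum_a|v_a|t_a$
(`localInner_self_le_sq_sum`). Scaling $x$ by $k$ divides this by $k$, so for $k=\frac32\sqrt
U\|t\|_2$ coordinatewise rounding of $kx$ stays in the ellipsoid. -/

namespace WSOS

/-! ### Local inner products at a positive definite matrix -/

section LocalInner

set_option linter.unusedSectionVars false

variable {ι : Type*} [Fintype ι] [DecidableEq ι]

/-- The local inner product `tr (X⁻¹ A X⁻¹ B)` at a positive definite matrix `X`. -/
noncomputable def localInner (X A B : Matrix ι ι ℝ) : ℝ := (X⁻¹ * A * (X⁻¹ * B)).trace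

theorem localInner_comm (X A B : Matrix ι ι ℝ) : localInner X A B = localInner X B A :=
  Matrix.trace_mul_comm _ _

theorem localInner_add_right (X A B D : Matrix ι ι ℝ) :
    localInner X A (B + D) = localInner X A B + localInner X A D := by
  simp [localInner, mul_add]

theorem localInner_smul_right (X A B : Matrix ι ι ℝ) (c : ℝ) :
    localInner X A (c • B) = c * localInner X A B := by
  simp [localInner]

theorem localInner_sub_right (X A B D : Matrix ι ι ℝ) :
    localInner X A (B - D) = localInner X A B - localInner X A D := by
  simp [localInner, mul_sub]

theorem localInner_sum_right {κ : Type*} (s : Finset κ) (X A : Matrix ι ι ℝ)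
    (B : κ → Matrix ι ι ℝ) :
    localInner X A (∑ k ∈ s, B k) = ∑ k ∈ s, localInner X A (B k) := by
  simp [localInner, Finset.mul_sum, Matrix.trace_sum]

/-- A positive definite matrix is congruent to the identity. -/
theorem exists_congruence {X : Matrix ι ι ℝ} (hX : X.PosDef) :
    ∃ C : Matrix ι ι ℝ, IsUnit C ∧ X⁻¹ = C.transpose * C ∧ C * X * C.transpose = 1 := by
  open scoped MatrixOrder Matrix.Norms.L2Operator in
  obtain ⟨C, hC, h⟩ := CStarAlgebra.isStrictlyPositive_iff_eq_star_mul_self.mp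
    (Matrix.PosDef.isStrictlyPositive hX.inv)
  have h' : X⁻¹ = C.transpose * C := by
    rw [h, Matrix.star_eq_conjTranspose, Matrix.conjTranspose_eq_transpose_of_trivial]
  refine ⟨C, hC, h', ?_⟩
  have hXu : IsUnit X.det := (Matrix.isUnit_iff_isUnit_det _).1 hX.isUnit
  have hCu : IsUnit C.det := (Matrix.isUnit_iff_isUnit_det _).1 hC
  have hCt : IsUnit C.transpose.det := by rwa [Matrix.det_transpose]
  have : X = C⁻¹ * C.transpose⁻¹ := by
    rw [← Matrix.mul_inv_rev, ← h', Matrix.nonsing_inv_nonsing_inv _ hXu]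
  rw [this, ← mul_assoc, Matrix.mul_nonsing_inv _ hCu, one_mul, Matrix.nonsing_inv_mul _ hCt]

theorem localInner_eq_trace {X C : Matrix ι ι ℝ} (h : X⁻¹ = C.transpose * C)
    (A B : Matrix ι ι ℝ) :
    localInner X A B = ((C * A * C.transpose) * (C * B * C.transpose)).trace := by
  rw [localInner, h, mul_assoc, mul_assoc, Matrix.trace_mul_comm C.transpose]
  simp only [mul_assoc]

theorem trace_inv_mul_eq {X C : Matrix ι ι ℝ} (h : X⁻¹ = C.transpose * C)
    (A : Matrix ι ι ℝ) : (X⁻¹ * A).trace = (C * A * C.transpose).trace := by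
  rw [h, Matrix.trace_mul_comm (C * A), mul_assoc]

theorem trace_transpose_mul_self_eq (A : Matrix ι ι ℝ) :
    (A.transpose * A).trace = ∑ i, ∑ j, A i j ^ 2 := by
  simp only [Matrix.trace, Matrix.diag, Matrix.mul_apply, Matrix.transpose_apply]
  rw [Finset.sum_comm]
  simp [sq]

theorem trace_mul_self_eq {A : Matrix ι ι ℝ} (hA : A.IsSymm) :
    (A * A).trace = ∑ i, ∑ j, A i j ^ 2 := by
  rw [← trace_transpose_mul_self_eq, hA.eq]

theorem isSymm_congruence {A : Matrix ι ι ℝ} (hA : A.IsSymm) (C : Matrix ι ι ℝ) :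
    (C * A * C.transpose).IsSymm := by
  simp [Matrix.IsSymm, Matrix.transpose_mul, hA.eq, mul_assoc]

theorem localInner_self_nonneg {X A : Matrix ι ι ℝ} (hX : X.PosDef) (hA : A.IsSymm) :
    0 ≤ localInner X A A := by
  obtain ⟨C, -, h, -⟩ := exists_congruence hX
  rw [localInner_eq_trace h, trace_mul_self_eq (isSymm_congruence hA C)]
  positivity

theorem eq_zero_of_localInner_self_eq_zero {X A : Matrix ι ι ℝ} (hX : X.PosDef)
    (hA : A.IsSymm) (h0 : localInner X A A = 0) : A = 0 := by
  obtain ⟨C, hC, h, -⟩ := exists_congruence hX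
  have hCt : IsUnit C.transpose := (Matrix.isUnit_transpose C).2 hC
  have hS := isSymm_congruence hA C
  rw [localInner_eq_trace h] at h0
  have hz : C * A * C.transpose = 0 := by
    rw [← Matrix.trace_conjTranspose_mul_self_eq_zero_iff,
      Matrix.conjTranspose_eq_transpose_of_trivial, hS.eq, h0]
  rw [hCt.mul_left_eq_zero, hC.mul_right_eq_zero] at hz
  exact hz

/-- Cauchy–Schwarz for the entries of $D$ and $xx^T$, whose Frobenius norm is $x^Tx$. -/
theorem sq_dotProduct_mulVec_le {D : Matrix ι ι ℝ} (hD : D.IsSymm) (x : ι → ℝ) :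
    (x ⬝ᵥ D.mulVec x) ^ 2 ≤ (D * D).trace * (x ⬝ᵥ x) ^ 2 := by
  have h1 : x ⬝ᵥ D.mulVec x = ∑ k : ι × ι, D k.1 k.2 * (x k.1 * x k.2) := by
    rw [Fintype.sum_prod_type]
    simp only [dotProduct, Matrix.mulVec, Finset.mul_sum]
    exact Finset.sum_congr rfl fun i _ => Finset.sum_congr rfl fun j _ => by ring
  have h2 : (x ⬝ᵥ x) ^ 2 = ∑ k : ι × ι, (x k.1 * x k.2) ^ 2 := by
    rw [Fintype.sum_prod_type, sq, dotProduct, Finset.sum_mul_sum]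
    exact Finset.sum_congr rfl fun i _ => Finset.sum_congr rfl fun j _ => by ring
  have h3 : (D * D).trace = ∑ k : ι × ι, D k.1 k.2 ^ 2 := by
    rw [trace_mul_self_eq hD, Fintype.sum_prod_type]
  rw [h1, h2, h3]
  exact Finset.sum_mul_sq_le_sq_mul_sq _ _ _

theorem isSymm_of_posSemidef {A : Matrix ι ι ℝ} (hA : A.PosSemidef) : A.IsSymm := by
  have := hA.1
  rwa [Matrix.IsHermitian, Matrix.conjTranspose_eq_transpose_of_trivial] at this

theorem isHermitian_of_isSymm {A : Matrix ι ι ℝ} (hA : A.IsSymm) : A.IsHermitian := by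
  rw [Matrix.IsHermitian, Matrix.conjTranspose_eq_transpose_of_trivial, hA.eq]

theorem posSemidef_congruence_iff {C A : Matrix ι ι ℝ} (hC : IsUnit C) :
    (C * A * C.transpose).PosSemidef ↔ A.PosSemidef := by
  have := Matrix.IsUnit.posSemidef_star_right_conjugate_iff (x := A) hC
  rwa [Matrix.star_eq_conjTranspose, Matrix.conjTranspose_eq_transpose_of_trivial] at this

theorem posDef_congruence_iff {C A : Matrix ι ι ℝ} (hC : IsUnit C) :
    (C * A * C.transpose).PosDef ↔ A.PosDef := by
  have := Matrix.IsUnit.posDef_star_right_conjugate_iff (x := A) hC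
  rwa [Matrix.star_eq_conjTranspose, Matrix.conjTranspose_eq_transpose_of_trivial] at this

/-- The closed unit ball of the local norm at `X` consists of positive semidefinite matrices. -/
theorem posSemidef_of_localInner_sub_le_one {X Y : Matrix ι ι ℝ} (hX : X.PosDef)
    (hY : Y.IsSymm) (h : localInner X (Y - X) (Y - X) ≤ 1) : Y.PosSemidef := by
  obtain ⟨C, hC, hXC, hCX⟩ := exists_congruence hX
  have hsymm := isSymm_congruence (hY.sub (isSymm_of_posSemidef hX.posSemidef)) C
  rw [localInner_eq_trace hXC] at h
  rw [← posSemidef_congruence_iff hC]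
  refine .of_dotProduct_mulVec_nonneg (isHermitian_of_isSymm (isSymm_congruence hY C)) fun x => ?_
  have h1 := sq_dotProduct_mulVec_le hsymm x
  have hx : 0 ≤ x ⬝ᵥ x := Finset.sum_nonneg fun i _ => mul_self_nonneg _
  -- Congruence by $C$ turns $X$ into $1$ and $Y$ into $1+D$ with $\mathrm{tr}\,D^2\le 1$, so
  -- $x^TDx\ge-x^Tx$.
  have h2 : C * Y * C.transpose = C * (Y - X) * C.transpose + 1 := by
    rw [mul_sub, sub_mul, hCX]; abel
  rw [h2, star_trivial, Matrix.add_mulVec, dotProduct_add, Matrix.one_mulVec]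
  have h3 := abs_le_of_sq_le_sq (h1.trans (mul_le_of_le_one_left (sq_nonneg _) h)) hx
  linarith [(abs_le.1 h3).1]

/-- The open unit ball of the local norm at `X` consists of positive definite matrices. -/
theorem posDef_of_localInner_sub_lt_one {X Y : Matrix ι ι ℝ} (hX : X.PosDef)
    (hY : Y.IsSymm) (h : localInner X (Y - X) (Y - X) < 1) : Y.PosDef := by
  obtain ⟨C, hC, hXC, hCX⟩ := exists_congruence hX
  have hsymm := isSymm_congruence (hY.sub (isSymm_of_posSemidef hX.posSemidef)) C
  rw [localInner_eq_trace hXC] at h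
  rw [← posDef_congruence_iff hC]
  refine .of_dotProduct_mulVec_pos (isHermitian_of_isSymm (isSymm_congruence hY C)) fun x hx0 => ?_
  have h1 := sq_dotProduct_mulVec_le hsymm x
  have hx : 0 < x ⬝ᵥ x := by
    have := Matrix.dotProduct_star_self_pos_iff.2 hx0
    rwa [star_trivial] at this
  have h2 : C * Y * C.transpose = C * (Y - X) * C.transpose + 1 := by
    rw [mul_sub, sub_mul, hCX]; abel
  rw [h2, star_trivial, Matrix.add_mulVec, dotProduct_add, Matrix.one_mulVec]
  have h3 : (C * (Y - X) * C.transpose * (C * (Y - X) * C.transpose)).trace * (x ⬝ᵥ x) ^ 2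
      < (x ⬝ᵥ x) ^ 2 := mul_lt_of_lt_one_left (by positivity) h
  linarith [(abs_lt.1 (abs_lt_of_sq_lt_sq (h1.trans_lt h3) hx.le)).1]

theorem exists_eq_transpose_mul_self {A : Matrix ι ι ℝ} (hA : A.PosSemidef) :
    ∃ E : Matrix ι ι ℝ, A = E.transpose * E := by
  open scoped MatrixOrder Matrix.Norms.L2Operator in
  obtain ⟨E, rfl⟩ := CStarAlgebra.nonneg_iff_eq_star_mul_self.mp hA.nonneg
  exact ⟨E, by rw [Matrix.star_eq_conjTranspose, Matrix.conjTranspose_eq_transpose_of_trivial]⟩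

/-- For $A=E^TE$ and $B=F^TF$ the trace is $\|FE^T\|_F^2$, and the Frobenius norm is
submultiplicative. -/
theorem trace_mul_mem_Icc {A B : Matrix ι ι ℝ} (hA : A.PosSemidef) (hB : B.PosSemidef) :
    (A * B).trace ∈ Set.Icc 0 (A.trace * B.trace) := by
  obtain ⟨E, rfl⟩ := exists_eq_transpose_mul_self hA
  obtain ⟨F, rfl⟩ := exists_eq_transpose_mul_self hB
  have h : (E.transpose * E * (F.transpose * F)).trace
      = ∑ i, ∑ j, (F * E.transpose) i j ^ 2 := by
    rw [← trace_transpose_mul_self_eq, Matrix.transpose_mul, Matrix.transpose_transpose,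
      mul_assoc, mul_assoc, Matrix.trace_mul_comm (E.transpose)]
    rw [Matrix.trace_mul_comm E]
    simp only [mul_assoc]
    rw [Matrix.trace_mul_comm E]
    simp only [mul_assoc]
  rw [h]
  refine ⟨by positivity, ?_⟩
  rw [trace_transpose_mul_self_eq, trace_transpose_mul_self_eq, mul_comm, Finset.sum_mul_sum]
  refine Finset.sum_le_sum fun i _ => Finset.sum_le_sum fun j _ => ?_
  exact Finset.sum_mul_sq_le_sq_mul_sq _ _ _

/-- Congruence reduces this to `trace_mul_mem_Icc`. It serves to bound Hessian entries by products
of gradient entries. -/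
theorem localInner_mem_Icc {X A B : Matrix ι ι ℝ} (hX : X.PosDef) (hA : A.PosSemidef)
    (hB : B.PosSemidef) :
    localInner X A B ∈ Set.Icc 0 ((X⁻¹ * A).trace * (X⁻¹ * B).trace) := by
  obtain ⟨C, hC, h, -⟩ := exists_congruence hX
  rw [localInner_eq_trace h, trace_inv_mul_eq h, trace_inv_mul_eq h]
  exact trace_mul_mem_Icc ((posSemidef_congruence_iff hC).2 hA) ((posSemidef_congruence_iff hC).2 hB)

/-- The local distance from `Y` to `Y X⁻¹ Y` at `Y` is the local distance from `X` to `Y` at `X`. -/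
theorem localInner_reflect {X Y : Matrix ι ι ℝ} (hX : IsUnit X.det) (hY : IsUnit Y.det) :
    localInner Y (Y * X⁻¹ * Y - Y) (Y * X⁻¹ * Y - Y) = localInner X (Y - X) (Y - X) := by
  rw [localInner, localInner]
  have h : Y⁻¹ * (Y * X⁻¹ * Y - Y) = X⁻¹ * (Y - X) := by
    rw [mul_sub, mul_sub, Matrix.nonsing_inv_mul _ hX, Matrix.nonsing_inv_mul _ hY, mul_assoc,
      Matrix.nonsing_inv_mul_cancel_left _ _ hY]
  rw [h]

end LocalInner

/-! ### Gradient and Hessian of $-\log\det\Lambda$ -/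

section LogDet

set_option linter.unusedSectionVars false

variable {ι κ : Type*} [Fintype ι] [DecidableEq ι] [Fintype κ]

theorem hasDerivAt_det_add_smul {X : Matrix ι ι ℝ} (hX : IsUnit X.det) (A : Matrix ι ι ℝ) :
    HasDerivAt (fun s : ℝ => (X + s • A).det) (X.det * (X⁻¹ * A).trace) 0 := by
  -- With $X$ factored out, $\det(1+sM)$ is a polynomial in $s$ whose first-order part is
  -- $1+s\,\mathrm{tr}\,M$.
  have h : (fun s : ℝ => (X + s • A).det) = fun s => X.det * (1 + (X⁻¹ * A).trace * s +
      (Matrix.det (1 + (Polynomial.X : Polynomial ℝ) •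
        (X⁻¹ * A).map Polynomial.C)).divX.divX.eval s * s ^ 2) := by
    funext s
    rw [← Matrix.det_one_add_smul, ← Matrix.det_mul, mul_add, mul_one, mul_smul_comm,
      Matrix.mul_nonsing_inv_cancel_left _ _ hX]
  rw [h]
  generalize (Matrix.det (1 + (Polynomial.X : Polynomial ℝ) •
        (X⁻¹ * A).map Polynomial.C)).divX.divX = P
  have h1 : HasDerivAt (fun s : ℝ => (X⁻¹ * A).trace * s) (X⁻¹ * A).trace 0 := by
    simpa using (hasDerivAt_id (0 : ℝ)).const_mul (X⁻¹ * A).trace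
  have h2 : HasDerivAt (fun s : ℝ => P.eval s * s ^ 2) 0 0 := by
    simpa using (P.hasDerivAt 0).fun_mul (hasDerivAt_pow 2 (0 : ℝ))
  simpa using ((h1.const_add 1).add h2).const_mul X.det

theorem continuousAt_inv_add_smul {X : Matrix ι ι ℝ} (hX : IsUnit X.det) (A : Matrix ι ι ℝ) :
    ContinuousAt (fun s : ℝ => (X + s • A)⁻¹) 0 := by
  have h1 : ContinuousAt (fun s : ℝ => X + s • A) 0 := by fun_prop
  have h2 : ContinuousAt Inv.inv (X + (0 : ℝ) • A) := by
    apply continuousAt_matrix_inv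
    rw [zero_smul, add_zero]
    simpa using NormedRing.inverse_continuousAt hX.unit
  exact ContinuousAt.comp (g := Inv.inv) h2 h1

theorem eventually_isUnit_det_add_smul {X : Matrix ι ι ℝ} (hX : IsUnit X.det)
    (A : Matrix ι ι ℝ) : ∀ᶠ s : ℝ in nhds 0, IsUnit (X + s • A).det := by
  have h : ContinuousAt (fun s : ℝ => (X + s • A).det) 0 :=
    (hasDerivAt_det_add_smul hX A).continuousAt
  have h0 : (X + (0 : ℝ) • A).det ≠ 0 := by simpa using hX.ne_zero
  exact (h.eventually_ne h0).mono fun s hs => hs.isUnit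

/-- The resolvent identity makes the difference quotient explicit, so continuity of the inverse
suffices. -/
theorem hasDerivAt_trace_inv_add_smul {X : Matrix ι ι ℝ} (hX : IsUnit X.det)
    (A B : Matrix ι ι ℝ) :
    HasDerivAt (fun s : ℝ => ((X + s • A)⁻¹ * B).trace) (-localInner X A B) 0 := by
  rw [hasDerivAt_iff_tendsto_slope]
  have h1 : ContinuousAt (fun s : ℝ => -((X + s • A)⁻¹ * A * (X⁻¹ * B)).trace) 0 := by
    have := continuousAt_inv_add_smul hX A
    fun_prop
  have h2 := h1.tendsto
  rw [zero_smul, add_zero] at h2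
  refine (h2.mono_left nhdsWithin_le_nhds).congr' ?_
  have h3 := (eventually_isUnit_det_add_smul hX A).filter_mono
    (nhdsWithin_le_nhds (s := ({0}ᶜ : Set ℝ)))
  filter_upwards [h3, self_mem_nhdsWithin] with s hs hs0
  have hs0 : s ≠ 0 := hs0
  have h4 : (X + s • A)⁻¹ - X⁻¹ = -(s • ((X + s • A)⁻¹ * A * X⁻¹)) := by
    have h5 : (X + s • A)⁻¹ * (X + s • A) * X⁻¹ = X⁻¹ := by
      rw [Matrix.nonsing_inv_mul _ hs, one_mul]
    rw [mul_add, add_mul, mul_assoc, Matrix.mul_nonsing_inv _ hX, mul_one] at h5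
    rw [mul_smul_comm, smul_mul_assoc] at h5
    rwa [sub_eq_iff_eq_add, neg_add_eq_sub, eq_sub_iff_add_eq]
  rw [slope_def_field, zero_smul, add_zero, sub_zero, ← Matrix.trace_sub, ← sub_mul, h4]
  simp [mul_assoc]
  field_simp

variable (Λ : (κ → ℝ) →ₗ[ℝ] Matrix ι ι ℝ)

theorem contDiff_det_linearMap {k : WithTop ℕ∞} : ContDiff ℝ k fun x => (Λ x).det := by
  have h : ∀ i j, ContDiff ℝ k fun x => Λ x i j := fun i j =>
    (LinearMap.toContinuousLinearMap ((Matrix.entryLinearMap ℝ ℝ i j).comp Λ)).contDiff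
  simp only [Matrix.det_apply]
  exact ContDiff.sum fun σ _ => (contDiff_prod fun i _ => h _ _).const_smul _

theorem continuous_linearMap_matrix : Continuous Λ := by
  open scoped Matrix.Norms.L2Operator in
  exact LinearMap.continuous_of_finiteDimensional Λ

theorem contDiffAt_neg_log_det {k : WithTop ℕ∞} {x : κ → ℝ} (hx : (Λ x).det ≠ 0) :
    ContDiffAt ℝ k (fun x => -Real.log (Λ x).det) x :=
  ((contDiff_det_linearMap Λ).contDiffAt.log hx).neg

theorem hasDerivAt_comp_line {F : Type*} [NormedAddCommGroup F] [NormedSpace ℝ F]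
    {f : (κ → ℝ) → F} {x : κ → ℝ} (hf : DifferentiableAt ℝ f x) (v : κ → ℝ) :
    HasDerivAt (fun s : ℝ => f (x + s • v)) (fderiv ℝ f x v) 0 := by
  have h1 : HasDerivAt (fun s : ℝ => x + s • v) v 0 := by
    simpa using ((hasDerivAt_id (0 : ℝ)).smul_const v).const_add x
  have h2 : HasFDerivAt f (fderiv ℝ f x) (x + (0 : ℝ) • v) := by
    simpa using hf.hasFDerivAt
  exact h2.comp_hasDerivAt 0 h1

theorem fderiv_neg_log_det {x : κ → ℝ} (hx : (Λ x).det ≠ 0) (v : κ → ℝ) :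
    fderiv ℝ (fun x => -Real.log (Λ x).det) x v = -((Λ x)⁻¹ * Λ v).trace := by
  have h1 := hasDerivAt_comp_line
    ((contDiffAt_neg_log_det (k := 1) Λ hx).differentiableAt one_ne_zero) v
  have h2 := hasDerivAt_det_add_smul hx.isUnit (Λ v)
  have h0 : (Λ x + (0 : ℝ) • Λ v).det ≠ 0 := by simpa using hx
  have h3 := (h2.log h0).neg
  have h4 : (fun s : ℝ => -Real.log (Λ (x + s • v)).det) =
      -fun s : ℝ => Real.log (Λ x + s • Λ v).det := by
    funext s; simp
  rw [h4] at h1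
  rw [h1.unique h3, zero_smul, add_zero, mul_div_cancel_left₀ _ hx]

/-- The second derivative of `x ↦ -log det Λ(x)`. -/
theorem fderiv_fderiv_neg_log_det {x : κ → ℝ} (hx : (Λ x).det ≠ 0) (u v : κ → ℝ) :
    fderiv ℝ (fderiv ℝ fun x => -Real.log (Λ x).det) x u v = localInner (Λ x) (Λ u) (Λ v) := by
  have hd : DifferentiableAt ℝ (fderiv ℝ fun x => -Real.log (Λ x).det) x :=
    ((contDiffAt_neg_log_det (k := 2) Λ hx).fderiv_right (m := 1) (by norm_num)).differentiableAt
      one_ne_zero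
  have h1 := (hasDerivAt_comp_line hd u).clm_apply (hasDerivAt_const 0 v)
  have h2 := (hasDerivAt_trace_inv_add_smul hx.isUnit (Λ u) (Λ v)).neg
  have h3 : (fun s : ℝ => fderiv ℝ (fun x => -Real.log (Λ x).det) (x + s • u) v) =ᶠ[nhds 0]
      -fun s : ℝ => ((Λ x + s • Λ u)⁻¹ * Λ v).trace := by
    filter_upwards [eventually_isUnit_det_add_smul hx.isUnit (Λ u)] with s hs
    have e : Λ (x + s • u) = Λ x + s • Λ u := by simp
    rw [fderiv_neg_log_det Λ (by rw [e]; exact hs.ne_zero), e]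
    rfl
  simpa using h1.unique (h2.congr_of_eventuallyEq h3)

theorem hessian_neg_log_det {U : ℕ} (Λ : (Fin U → ℝ) →ₗ[ℝ] Matrix ι ι ℝ) {x : Fin U → ℝ}
    (hx : (Λ x).det ≠ 0) (a b : Fin U) :
    hessian (fun x => -Real.log (Λ x).det) x a b =
      localInner (Λ x) (Λ (Pi.single a 1)) (Λ (Pi.single b 1)) :=
  fderiv_fderiv_neg_log_det Λ hx _ _

end LogDet

/-! ### Dikin ellipsoids and gradient certificates for a spectrahedral cone -/

section LogDetBarrier

set_option linter.unusedSectionVars false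

variable {ι : Type*} [Fintype ι] [DecidableEq ι] {U : ℕ}

theorem localInner_add_self (X A B : Matrix ι ι ℝ) :
    localInner X (A + B) (A + B) =
      localInner X A A + 2 * localInner X A B + localInner X B B := by
  rw [localInner_add_right, localInner_comm X (A + B) A, localInner_comm X (A + B) B,
    localInner_add_right, localInner_add_right, localInner_comm X B A]
  ring

theorem isClosed_posSemidef : IsClosed {A : Matrix ι ι ℝ | A.PosSemidef} := by
  have h : {A : Matrix ι ι ℝ | A.PosSemidef} =
      {A | A.conjTranspose = A} ∩ ⋂ x : ι → ℝ, {A | 0 ≤ star x ⬝ᵥ A.mulVec x} := by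
    ext A
    simp only [Set.mem_ofPred_eq, Set.mem_inter_iff, Set.mem_iInter,
      Matrix.posSemidef_iff_dotProduct_mulVec, Matrix.IsHermitian]
  rw [h]
  refine IsClosed.inter (isClosed_eq (by fun_prop) continuous_id) (isClosed_iInter fun x => ?_)
  exact isClosed_le continuous_const (by fun_prop)

variable (Λ : (Fin U → ℝ) →ₗ[ℝ] Matrix ι ι ℝ)

/-- The Hessian of `x ↦ -log det Λ(x)` at a point `y` with `Λ(y) = Y`. -/
noncomputable def gramMatrix (Y : Matrix ι ι ℝ) : Matrix (Fin U) (Fin U) ℝ :=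
  Matrix.of fun a b => localInner Y (Λ (Pi.single a 1)) (Λ (Pi.single b 1))

theorem linearMap_eq_sum_single (v : Fin U → ℝ) : Λ v = ∑ a, v a • Λ (Pi.single a 1) := by
  conv_lhs => rw [pi_eq_sum_univ' v]
  simp [map_sum]

theorem dotProduct_gramMatrix_mulVec (Y : Matrix ι ι ℝ) (u v : Fin U → ℝ) :
    v ⬝ᵥ (gramMatrix Λ Y).mulVec u = localInner Y (Λ v) (Λ u) := by
  have h : ∀ a, (gramMatrix Λ Y).mulVec u a = localInner Y (Λ u) (Λ (Pi.single a 1)) := by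
    intro a
    rw [localInner_comm, linearMap_eq_sum_single Λ u, localInner_sum_right]
    simp only [Matrix.mulVec, dotProduct, gramMatrix, Matrix.of_apply, localInner_smul_right]
    exact Finset.sum_congr rfl fun b _ => mul_comm _ _
  rw [localInner_comm, linearMap_eq_sum_single Λ v, localInner_sum_right]
  simp only [dotProduct, h, localInner_smul_right]

variable {Λ}

theorem isUnit_gramMatrix (hsymm : ∀ v, (Λ v).IsSymm) (hinj : ∀ v, Λ v = 0 → v = 0)
    {Y : Matrix ι ι ℝ} (hY : Y.PosDef) : IsUnit (gramMatrix Λ Y) := by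
  rw [← Matrix.mulVec_injective_iff_isUnit, ← Matrix.coe_mulVecLin, ← LinearMap.ker_eq_bot,
    LinearMap.ker_eq_bot']
  intro u hu
  rw [Matrix.mulVecLin_apply] at hu
  have h := dotProduct_gramMatrix_mulVec Λ Y u u
  rw [hu, dotProduct_zero] at h
  exact hinj u (eq_zero_of_localInner_self_eq_zero hY (hsymm u) h.symm)

/-- If `t = -g(x)` and `y` is in the unit Dikin ellipsoid at `x`, then `H(y)⁻¹ t` is in the
domain of the barrier. -/
theorem posSemidef_gramMatrix_inv_mulVec (hsymm : ∀ v, (Λ v).IsSymm)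
    (hinj : ∀ v, Λ v = 0 → v = 0) {x y t : Fin U → ℝ} (hx : (Λ x).PosDef) (hy : (Λ y).PosDef)
    (ht : ∀ v, ((Λ x)⁻¹ * Λ v).trace = t ⬝ᵥ v)
    (hxy : localInner (Λ x) (Λ y - Λ x) (Λ y - Λ x) ≤ 1) :
    (Λ ((gramMatrix Λ (Λ y))⁻¹.mulVec t)).PosSemidef := by
  set u := (gramMatrix Λ (Λ y))⁻¹.mulVec t with hu
  set X := Λ x
  set Y := Λ y with hYdef
  have hXu : IsUnit X.det := (Matrix.isUnit_iff_isUnit_det _).1 hx.isUnit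
  have hYu : IsUnit Y.det := (Matrix.isUnit_iff_isUnit_det _).1 hy.isUnit
  have hHu : (gramMatrix Λ Y).mulVec u = t := by
    rw [hu, Matrix.mulVec_mulVec, Matrix.mul_nonsing_inv _
      ((Matrix.isUnit_iff_isUnit_det _).1 (isUnit_gramMatrix hsymm hinj hy)), Matrix.one_mulVec]
  -- On all symmetric matrices the Hessian at $Y$ is $A\mapsto Y^{-1}AY^{-1}$; $Z$ is its inverse
  -- applied to $X^{-1}$.
  set Z := Y * X⁻¹ * Y with hZ
  have hZsymm : Z.IsSymm := by
    rw [Matrix.IsSymm, hZ, Matrix.transpose_mul, Matrix.transpose_mul, (hsymm y).eq,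
      Matrix.transpose_nonsing_inv, (hsymm x).eq, mul_assoc]
  -- Against $\Lambda v$, both $Z$ and $\Lambda u$ have local inner product
  -- $\mathrm{tr}(X^{-1}\Lambda v)=t^Tv$, so $\Lambda u$ is the projection of $Z$.
  have horth : ∀ v, localInner Y (Λ v) (Z - Λ u) = 0 := by
    intro v
    rw [localInner_sub_right, ← dotProduct_gramMatrix_mulVec, hHu, dotProduct_comm, ← ht, sub_eq_zero,
      localInner, hZ, mul_assoc Y, Matrix.nonsing_inv_mul_cancel_left _ _ hYu, ← mul_assoc,
      Matrix.trace_mul_comm, ← mul_assoc, ← mul_assoc, Matrix.mul_nonsing_inv _ hYu, one_mul,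
      Matrix.trace_mul_comm]
  have h0 := horth (u - y)
  rw [map_sub, ← hYdef] at h0
  refine posSemidef_of_localInner_sub_le_one hy (hsymm u) (le_trans ?_ hxy)
  rw [← localInner_reflect hXu hYu, ← hZ]
  have hpos := localInner_self_nonneg hy (hZsymm.sub (hsymm u))
  -- Pythagoras: $\Lambda u-Y$ lies in the range of $\Lambda$, orthogonal to $Z-\Lambda u$.
  have hsplit : Z - Y = (Λ u - Y) + (Z - Λ u) := by abel
  rw [hsplit, localInner_add_self, h0]
  linarith

/-- The local norm at `x` is dominated by the gradient. -/
theorem localInner_self_le_sq_sum {x t : Fin U → ℝ} (hx : (Λ x).PosDef)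
    (ht : ∀ v, ((Λ x)⁻¹ * Λ v).trace = t ⬝ᵥ v)
    (hE : ∀ a, (Λ (Pi.single a 1)).PosSemidef) (v : Fin U → ℝ) :
    localInner (Λ x) (Λ v) (Λ v) ≤ (∑ a, |v a| * t a) ^ 2 := by
  rw [← dotProduct_gramMatrix_mulVec, sq, Finset.sum_mul_sum]
  simp only [dotProduct, Matrix.mulVec, gramMatrix, Matrix.of_apply, Finset.mul_sum]
  refine Finset.sum_le_sum fun a _ => Finset.sum_le_sum fun b _ => ?_
  have h := localInner_mem_Icc hx (hE a) (hE b)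
  rw [ht, ht, dotProduct_single, dotProduct_single, mul_one, mul_one] at h
  set c := localInner (Λ x) (Λ (Pi.single a 1)) (Λ (Pi.single b 1))
  calc v a * (c * v b) = (v a * v b) * c := by ring
    _ ≤ |v a * v b| * c := mul_le_mul_of_nonneg_right (le_abs_self _) h.1
    _ ≤ |v a * v b| * (t a * t b) := mul_le_mul_of_nonneg_left h.2 (abs_nonneg _)
    _ = _ := by rw [abs_mul]; ring

/-- A functional that is positive on the domain of the barrier is minus the gradient of the barrier
at some point. -/
theorem exists_gradient_eq [Nonempty ι] (hsymm : ∀ v, (Λ v).IsSymm) {t x₀ : Fin U → ℝ} {c : ℝ}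
    (hc : 0 < c) (ht : ∀ v, (Λ v).PosSemidef → c * ‖v‖ ≤ t ⬝ᵥ v) (hx₀ : (Λ x₀).PosDef) :
    ∃ x, (Λ x).PosDef ∧ ∀ v, ((Λ x)⁻¹ * Λ v).trace = t ⬝ᵥ v := by
  set ν : ℝ := (Fintype.card ι : ℝ) with hν
  have hν0 : 0 < ν := by rw [hν]; exact_mod_cast Fintype.card_pos
  have hΛc : Continuous Λ := continuous_linearMap_matrix Λ
  have hdotc : Continuous fun v : Fin U → ℝ => t ⬝ᵥ v := by fun_prop
  -- The slice value $\nu=\mathrm{tr}(X^{-1}X)$ makes the Lagrange multiplier at the maximizer of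
  -- $\det\Lambda$ equal to $1$.
  let S : Set (Fin U → ℝ) := {v | (Λ v).PosSemidef ∧ t ⬝ᵥ v = ν}
  have hScomp : IsCompact S := by
    refine Metric.isCompact_of_isClosed_isBounded ?_ ?_
    · exact (isClosed_posSemidef.preimage hΛc).inter (isClosed_eq hdotc continuous_const)
    · refine (Metric.isBounded_closedBall (x := (0 : Fin U → ℝ)) (r := ν / c)).subset ?_
      rintro v ⟨hv, hv'⟩
      rw [mem_closedBall_zero_iff, le_div_iff₀ hc, mul_comm, ← hv']
      exact ht v hv
  have htx₀ : 0 < t ⬝ᵥ x₀ := by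
    refine lt_of_lt_of_le (mul_pos hc (norm_pos_iff.2 ?_)) (ht x₀ hx₀.posSemidef)
    rintro rfl
    have := hx₀.trace_pos
    simp at this
  have hx₁ : (Λ ((ν / (t ⬝ᵥ x₀)) • x₀)).PosDef := by
    rw [map_smul]; exact hx₀.smul (div_pos hν0 htx₀)
  have hx₁S : (ν / (t ⬝ᵥ x₀)) • x₀ ∈ S := by
    refine ⟨hx₁.posSemidef, ?_⟩
    rw [dotProduct_smul, smul_eq_mul, div_mul_cancel₀ _ htx₀.ne']
  obtain ⟨x, ⟨hxpsd, hxt⟩, hmax⟩ := hScomp.exists_isMaxOn ⟨_, hx₁S⟩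
    (f := fun v => (Λ v).det) hΛc.matrix_det.continuousOn
  have hdet : 0 < (Λ x).det := hx₁.det_pos.trans_le (hmax hx₁S)
  have hxpd : (Λ x).PosDef := hxpsd.posDef_iff_det_ne_zero.2 hdet.ne'
  have htan : ∀ v, t ⬝ᵥ v = 0 → ((Λ x)⁻¹ * Λ v).trace = 0 := by
    intro v hv
    have hder := hasDerivAt_det_add_smul hdet.ne'.isUnit (Λ v)
    -- Positive definiteness persists for small $s$, and a direction with $t^Tv=0$ keeps the point
    -- on the slice.
    have hloc : IsLocalMax (fun s : ℝ => (Λ x + s • Λ v).det) 0 := by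
      have hcont : ContinuousAt (fun s : ℝ => s * (s * localInner (Λ x) (Λ v) (Λ v))) 0 := by
        fun_prop
      have hev := hcont.eventually_lt (g := fun _ => (1 : ℝ)) continuousAt_const (by simp)
      filter_upwards [hev] with s hs
      have hmem : x + s • v ∈ S := by
        refine ⟨(posDef_of_localInner_sub_lt_one hxpd (hsymm _) ?_).posSemidef, ?_⟩
        · rw [map_add, map_smul, add_sub_cancel_left, localInner_smul_right, localInner_comm,
            localInner_smul_right]
          exact hs
        · rw [dotProduct_add, dotProduct_smul, hv, hxt]; simp
      have := hmax hmem
      simpa using this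
    exact (mul_eq_zero.1 (hloc.hasDerivAt_eq_zero hder)).resolve_left hdet.ne'
  refine ⟨x, hxpd, fun v => ?_⟩
  -- Removing the multiple of $x$ with the same value of $t$ leaves a tangent vector.
  have h := htan (v - ((t ⬝ᵥ v) / ν) • x) (by
    rw [dotProduct_sub, dotProduct_smul, hxt, smul_eq_mul, div_mul_cancel₀ _ hν0.ne', sub_self])
  rw [map_sub, map_smul, mul_sub, Matrix.trace_sub, mul_smul_comm, Matrix.trace_smul,
    Matrix.nonsing_inv_mul _ hdet.ne'.isUnit, Matrix.trace_one, smul_eq_mul, ← hν,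
    div_mul_cancel₀ _ hν0.ne', sub_eq_zero] at h
  exact h

end LogDetBarrier

/-! ### Dual cones in $\mathbb R^U$ -/

section DualCone

variable {U : ℕ}

theorem isClosed_dualCone (K : Set (Fin U → ℝ)) : IsClosed (dualCone K) := by
  have h : dualCone K = ⋂ x ∈ K, {y | 0 ≤ x ⬝ᵥ y} := by
    ext y; simp [dualCone]
  rw [h]
  exact isClosed_biInter fun x _ => isClosed_le continuous_const (by fun_prop)

theorem dotProduct_nonneg_of_mem_closure {K : Set (Fin U → ℝ)} {s y : Fin U → ℝ}
    (hs : s ∈ closure K) (hy : y ∈ dualCone K) : 0 ≤ s ⬝ᵥ y := by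
  have hcl : IsClosed {s : Fin U → ℝ | 0 ≤ s ⬝ᵥ y} :=
    isClosed_le continuous_const (by fun_prop)
  exact closure_minimal (fun x hx => hy x hx) hcl hs

theorem isLeast_kOne {K : Set (Fin U → ℝ)} (e : Fin U → ℝ)
    (h : ∃ v ∈ dualCone K, ‖v‖ = 1) : IsLeast (kOneSet K e) (kOne K e) := by
  have himage : kOneSet K e = (fun v => e ⬝ᵥ v) '' (dualCone K ∩ Metric.sphere 0 1) := by
    ext c
    simp only [kOneSet, Set.mem_image, Set.mem_inter_iff, mem_sphere_zero_iff_norm]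
    exact ⟨fun ⟨v, hv, h1, hc⟩ => ⟨v, ⟨hv, h1⟩, hc.symm⟩,
      fun ⟨v, ⟨hv, h1⟩, hc⟩ => ⟨v, hv, h1, hc.symm⟩⟩
  have hcomp : IsCompact (kOneSet K e) := by
    rw [himage]
    exact ((isCompact_sphere _ _).inter_left (isClosed_dualCone K)).image (by fun_prop)
  obtain ⟨v, hv, h1⟩ := h
  exact hcomp.isLeast_sInf ⟨_, v, hv, h1, rfl⟩

/-- An interior point of a cone is bounded away from zero on the dual cone. -/
theorem exists_pos_mul_norm_le {K : Set (Fin U → ℝ)} {t : Fin U → ℝ} (ht : t ∈ interior K) :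
    ∃ c > 0, ∀ v ∈ dualCone K, c * ‖v‖ ≤ t ⬝ᵥ v := by
  obtain ⟨r, hr, hball⟩ := Metric.isOpen_iff.1 isOpen_interior t ht
  refine ⟨r / 2, by positivity, fun v hv => ?_⟩
  -- Both $t\pm\frac r2e_a$ remain in $K$; pairing them with $v$ bounds $|v_a|$.
  have key : ∀ (a : Fin U) (s : ℝ), |s| = r / 2 → 0 ≤ t ⬝ᵥ v + s * v a := by
    intro a s hs
    have hmem : t + Pi.single a s ∈ K := by
      apply interior_subset
      apply hball
      rw [Metric.mem_ball, dist_eq_norm, add_sub_cancel_left, Pi.norm_single, Real.norm_eq_abs, hs]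
      linarith
    have := hv _ hmem
    rwa [add_dotProduct, single_dotProduct] at this
  have hcoord : ∀ a, r / 2 * |v a| ≤ t ⬝ᵥ v := by
    intro a
    have h1 := key a (r / 2) (abs_of_pos (by positivity))
    have h2 := key a (-(r / 2)) (by rw [abs_neg, abs_of_pos (by positivity)])
    rcases abs_cases (v a) with ⟨h, _⟩ | ⟨h, _⟩ <;> rw [h] <;> linarith
  have h0 : 0 ≤ t ⬝ᵥ v := hv _ (interior_subset ht)
  rw [← le_div_iff₀' (by positivity)]
  refine (pi_norm_le_iff_of_nonneg (by positivity)).2 fun a => ?_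
  rw [le_div_iff₀' (by positivity), Real.norm_eq_abs]
  exact hcoord a

theorem smul_mem_dualCone {K : Set (Fin U → ℝ)} {v : Fin U → ℝ} {c : ℝ} (hc : 0 ≤ c)
    (hv : v ∈ dualCone K) : c • v ∈ dualCone K := by
  intro x hx
  rw [dotProduct_smul]
  exact mul_nonneg hc (hv x hx)

theorem sum_le_sqrt_mul_norm2 (t : Fin U → ℝ) : ∑ a, t a ≤ √(U : ℝ) * norm2 t := by
  have h : norm2 t = √(∑ a, t a ^ 2) := by
    simp [norm2, EuclideanSpace.norm_eq]
  rw [h, ← Real.sqrt_mul (Nat.cast_nonneg U)]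
  apply Real.le_sqrt_of_sq_le
  simpa using sq_sum_le_card_mul_sum_sq (s := Finset.univ) (f := t)

theorem abs_apply_le_norm2 (t : Fin U → ℝ) (a : Fin U) : |t a| ≤ norm2 t := by
  simpa [norm2] using PiLp.norm_apply_le (WithLp.toLp 2 t) a

end DualCone

/-! ### WSOS polynomials in the Lagrange basis -/

section Polynomials

variable {n m : ℕ} {w : Fin m → MvPolynomial (Fin n) ℝ} {d : Fin m → ℕ}

theorem sosCone_subset_polyDeg {k : ℕ} : sosCone n k ⊆ polyDeg n (2 * k) := by
  rintro _ ⟨r, g, hg, rfl⟩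
  refine Submodule.sum_mem _ fun j _ => ?_
  have := hg j
  rw [mem_restrictTotalDegree] at this ⊢
  exact (totalDegree_pow _ _).trans (Nat.mul_le_mul_left 2 this)

theorem wsosPolys_subset_wSpace : wsosPolys w d ⊆ wSpace w d := by
  rintro _ ⟨σ, hσ, rfl⟩
  exact ⟨σ, fun i => sosCone_subset_polyDeg (hσ i), rfl⟩

theorem zero_mem_sosCone (k : ℕ) : (0 : MvPolynomial (Fin n) ℝ) ∈ sosCone n k :=
  ⟨0, Fin.elim0, fun j => j.elim0, by simp⟩

theorem sq_mem_sosCone {k : ℕ} {g : MvPolynomial (Fin n) ℝ} (hg : g ∈ polyDeg n k) :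
    g ^ 2 ∈ sosCone n k :=
  ⟨1, fun _ => g, fun _ => hg, by simp⟩

theorem mul_sq_mem_wsosPolys (i : Fin m) {g : MvPolynomial (Fin n) ℝ}
    (hg : g ∈ polyDeg n (d i)) : w i * g ^ 2 ∈ wsosPolys w d := by
  refine ⟨Pi.single i (g ^ 2), fun j => ?_, ?_⟩
  · rcases eq_or_ne j i with rfl | h
    · rw [Pi.single_eq_same]; exact sq_mem_sosCone hg
    · rw [Pi.single_eq_of_ne h]; exact zero_mem_sosCone _
  · rw [Finset.sum_eq_single i]
    · simp
    · intro j _ h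
      simp [Pi.single_eq_of_ne h]
    · simp

theorem eval_nonneg_of_mem_wsosPolys {f : MvPolynomial (Fin n) ℝ} (hf : f ∈ wsosPolys w d)
    {x : Fin n → ℝ} (hx : x ∈ semialgSet w) : 0 ≤ eval x f := by
  obtain ⟨σ, hσ, rfl⟩ := hf
  rw [map_sum]
  refine Finset.sum_nonneg fun i _ => ?_
  obtain ⟨r, g, -, hg⟩ := hσ i
  rw [map_mul, hg, map_sum]
  refine mul_nonneg (hx i) (Finset.sum_nonneg fun j _ => ?_)
  rw [map_pow]
  positivity

theorem one_mem_polyDeg (k : ℕ) : (1 : MvPolynomial (Fin n) ℝ) ∈ polyDeg n k := by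
  rw [mem_restrictTotalDegree, totalDegree_one]; exact Nat.zero_le _

variable {U : ℕ} {q : Module.Basis (Fin U) ℝ (wSpace w d)}

theorem pos_of_basis_wSpace (hm : 0 < m) (hw : ∀ i, w i ≠ 0)
    (q : Module.Basis (Fin U) ℝ (wSpace w d)) : 0 < U := by
  rcases Nat.eq_zero_or_pos U with rfl | h
  · exfalso
    let i : Fin m := ⟨0, hm⟩
    have hmem := mul_mul_mem_wSpace w d i (one_mem_polyDeg _) (one_mem_polyDeg _)
    have : Subsingleton (wSpace w d) := q.repr.toEquiv.subsingleton
    have h0 := congrArg Subtype.val (Subsingleton.elim (⟨_, hmem⟩ : wSpace w d) 0)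
    exact hw i (by simpa using h0)
  · exact h

variable {z : Fin U → Fin n → ℝ}

theorem eval_toPoly
    (hq : ∀ i j, eval (z j) (q i : MvPolynomial (Fin n) ℝ) = if i = j then 1 else 0)
    (s : Fin U → ℝ) (l : Fin U) : eval (z l) (toPoly q s) = s l := by
  simp [toPoly, hq, smul_eval]

theorem eq_toPoly_repr (f : wSpace w d) : (f : MvPolynomial (Fin n) ℝ) = toPoly q (q.repr f) := by
  have h := congrArg (wSpace w d).subtype (q.sum_repr f)
  simp only [map_sum, map_smul, Submodule.subtype_apply] at h
  exact h.symm

theorem repr_apply_eq_eval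
    (hq : ∀ i j, eval (z j) (q i : MvPolynomial (Fin n) ℝ) = if i = j then 1 else 0)
    (f : wSpace w d) (l : Fin U) : q.repr f l = eval (z l) (f : MvPolynomial (Fin n) ℝ) := by
  rw [eq_toPoly_repr (q := q) f, eval_toPoly hq]

theorem toPoly_eval
    (hq : ∀ i j, eval (z j) (q i : MvPolynomial (Fin n) ℝ) = if i = j then 1 else 0)
    {f : MvPolynomial (Fin n) ℝ} (hf : f ∈ wSpace w d) :
    toPoly q (fun l => eval (z l) f) = f := by
  obtain ⟨g, rfl⟩ : ∃ g : wSpace w d, (g : MvPolynomial (Fin n) ℝ) = f := ⟨⟨f, hf⟩, rfl⟩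
  simp only [← repr_apply_eq_eval hq g]
  exact (eq_toPoly_repr g).symm

/-- The vector of values of a WSOS polynomial at the nodes is in the cone. -/
theorem eval_mem_cone
    (hq : ∀ i j, eval (z j) (q i : MvPolynomial (Fin n) ℝ) = if i = j then 1 else 0)
    {f : MvPolynomial (Fin n) ℝ} (hf : f ∈ wsosPolys w d) :
    (fun l => eval (z l) f) ∈ cone w d q := by
  change toPoly q _ ∈ wsosPolys w d
  rwa [toPoly_eval hq (wsosPolys_subset_wSpace hf)]

theorem evalBasis_mem_dualCone {x : Fin n → ℝ} (hx : x ∈ semialgSet w) :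
    evalBasis q x ∈ dualCone (cone w d q) := by
  intro s hs
  have h := eval_nonneg_of_mem_wsosPolys hs hx
  rw [toPoly, map_sum] at h
  simpa [dotProduct, evalBasis, smul_eval] using h

theorem evalBasis_node
    (hq : ∀ i j, eval (z j) (q i : MvPolynomial (Fin n) ℝ) = if i = j then 1 else 0)
    (a : Fin U) : evalBasis q (z a) = Pi.single a 1 := by
  ext l
  rw [evalBasis, hq, Pi.single_apply]

theorem single_mem_dualCone
    (hq : ∀ i j, eval (z j) (q i : MvPolynomial (Fin n) ℝ) = if i = j then 1 else 0)
    (hz : ∀ i, z i ∈ semialgSet w) (a : Fin U) :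
    Pi.single a 1 ∈ dualCone (cone w d q) := by
  rw [← evalBasis_node hq a]
  exact evalBasis_mem_dualCone (hz a)

theorem toPoly_ones
    (hq : ∀ i j, eval (z j) (q i : MvPolynomial (Fin n) ℝ) = if i = j then 1 else 0)
    (h1 : (1 : MvPolynomial (Fin n) ℝ) ∈ wSpace w d) : toPoly q (ones U) = 1 := by
  have h : ones U = fun l => eval (z l) (1 : MvPolynomial (Fin n) ℝ) :=
    funext fun l => (map_one _).symm
  rw [h, toPoly_eval hq h1]

/-- The sum of $\mu+f$ and $\mu-f$ is the constant $2\mu$. -/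
theorem one_mem_wSpace {μ : ℝ} (hμ : 0 < μ) {f : MvPolynomial (Fin n) ℝ}
    (hp : C μ + f ∈ wsosPolys w d) (hn : C μ - f ∈ wsosPolys w d) :
    (1 : MvPolynomial (Fin n) ℝ) ∈ wSpace w d := by
  have h := Submodule.smul_mem _ (1 / (2 * μ)) (Submodule.add_mem _
    (wsosPolys_subset_wSpace hp) (wsosPolys_subset_wSpace hn))
  have h2 : (1 / (2 * μ)) • (C μ + f + (C μ - f)) = (1 : MvPolynomial (Fin n) ℝ) := by
    rw [add_add_sub_cancel, ← C_add, smul_eq_C_mul, ← C_mul, ← C_1]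
    congr 1
    field_simp
    ring
  rwa [h2] at h

/-- On the dual cone, the maximum norm is controlled by the all-ones functional. -/
theorem abs_apply_le_of_mem_dualCone
    (hq : ∀ i j, eval (z j) (q i : MvPolynomial (Fin n) ℝ) = if i = j then 1 else 0) {μ : ℝ}
    (hp : ∀ i, C μ + (q i : MvPolynomial (Fin n) ℝ) ∈ wsosPolys w d)
    (hn : ∀ i, C μ - (q i : MvPolynomial (Fin n) ℝ) ∈ wsosPolys w d)
    {v : Fin U → ℝ} (hv : v ∈ dualCone (cone w d q)) (i : Fin U) :
    |v i| ≤ μ * (ones U ⬝ᵥ v) := by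
  have h1 := hv _ (eval_mem_cone hq (hp i))
  have h2 := hv _ (eval_mem_cone hq (hn i))
  simp only [dotProduct, map_add, map_sub, eval_C, hq, add_mul, sub_mul, ite_mul, one_mul, zero_mul,
    Finset.sum_add_distrib, Finset.sum_sub_distrib, Finset.sum_ite_eq, Finset.mem_univ, if_true,
    ← Finset.mul_sum] at h1 h2
  simp only [dotProduct, ones, one_mul]
  exact abs_le.2 ⟨by linarith, by linarith⟩

theorem one_le_of_mem_wsosPolys
    (hq : ∀ i j, eval (z j) (q i : MvPolynomial (Fin n) ℝ) = if i = j then 1 else 0)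
    (hz : ∀ i, z i ∈ semialgSet w) {μ : ℝ} (i : Fin U)
    (hn : C μ - (q i : MvPolynomial (Fin n) ℝ) ∈ wsosPolys w d) : 1 ≤ μ := by
  have h := eval_nonneg_of_mem_wsosPolys hn (hz i)
  simp only [map_sub, eval_C, hq, if_true] at h
  linarith

theorem isNodeMatrix_one
    (hq : ∀ i j, eval (z j) (q i : MvPolynomial (Fin n) ℝ) = if i = j then 1 else 0)
    (hz : ∀ i, z i ∈ semialgSet w) (hu : IsUnisolvent (wSpace w d) (Set.range z)) :
    IsNodeMatrix w d q 1 := by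
  refine ⟨U, z, 1, le_rfl, fun i j hij => ?_, hz, hu, fun _ => zero_lt_one, ?_⟩
  · by_contra hne
    have h1 := hq i i
    rw [hij, hq, if_neg hne, if_pos rfl] at h1
    exact zero_ne_one h1
  · ext i j
    simp [Matrix.sum_apply, evalBasis_node hq, Matrix.vecMulVec_apply, Matrix.one_apply,
      Pi.single_apply]

theorem cond_one (hU : 0 < U) : cond (1 : Matrix (Fin U) (Fin U) ℝ) = 1 := by
  have : Nonempty (Fin U) := ⟨⟨0, hU⟩⟩
  rw [cond, spectrum.one_eq, csSup_singleton, csInf_singleton, div_one]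

end Polynomials

/-! ### The spectrahedral description of $\Sigma^*$ -/

section Lambda

variable {n m U : ℕ} {w : Fin m → MvPolynomial (Fin n) ℝ} {d : Fin m → ℕ}
  {q : Module.Basis (Fin U) ℝ (wSpace w d)} {L : Fin m → ℕ}
  {p : (i : Fin m) → Module.Basis (Fin (L i)) ℝ (polyDeg n (d i))} {z : Fin U → Fin n → ℝ}

theorem lam_apply
    (hq : ∀ i j, eval (z j) (q i : MvPolynomial (Fin n) ℝ) = if i = j then 1 else 0)
    (i : Fin m) (v : Fin U → ℝ) (j k : Fin (L i)) :
    lam w d q p i v j k = ∑ l, eval (z l) (w i * ((p i j : MvPolynomial (Fin n) ℝ) *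
      (p i k : MvPolynomial (Fin n) ℝ))) * v l := by
  rw [lam, Matrix.of_apply]
  exact Finset.sum_congr rfl fun l _ => by rw [repr_apply_eq_eval hq]

theorem lam_isSymm (i : Fin m) (v : Fin U → ℝ) : (lam w d q p i v).IsSymm := by
  ext j k
  simp only [Matrix.transpose_apply, lam, Matrix.of_apply]
  simp only [mul_comm (p i k : MvPolynomial (Fin n) ℝ) (p i j : MvPolynomial (Fin n) ℝ)]

variable (w d q p) in
/-- `Λ` as a linear map. -/
noncomputable def lamLinear :
    (Fin U → ℝ) →ₗ[ℝ] Matrix ((i : Fin m) × Fin (L i)) ((i : Fin m) × Fin (L i)) ℝ where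
  toFun := lamBlock w d q p
  map_add' u v := by
    rw [lamBlock, lamBlock, lamBlock, ← Matrix.blockDiagonal'_add]
    congr 1
    ext i j k
    simp [lam, mul_add, Finset.sum_add_distrib]
  map_smul' c v := by
    rw [lamBlock, lamBlock, RingHom.id_apply, ← Matrix.blockDiagonal'_smul]
    congr 1
    ext i j k
    simp [lam, Finset.mul_sum, mul_left_comm]

theorem lamLinear_apply (v : Fin U → ℝ) :
    lamLinear w d q p v = Matrix.blockDiagonal' fun i => lam w d q p i v := rfl

theorem lamLinear_isSymm (v : Fin U → ℝ) : (lamLinear w d q p v).IsSymm := by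
  rw [Matrix.IsSymm, lamLinear_apply, Matrix.blockDiagonal'_transpose]
  congr 1
  exact funext fun i => lam_isSymm i v

/-- This links semidefiniteness to duality: the right side pairs $v$ with the WSOS polynomial
$w_ig^2$, where $g$ has coordinates $c$ in $p_i$, because Lagrange coordinates are node values. -/
theorem lam_dotProduct_mulVec
    (hq : ∀ i j, eval (z j) (q i : MvPolynomial (Fin n) ℝ) = if i = j then 1 else 0)
    (i : Fin m) (v : Fin U → ℝ) (c : Fin (L i) → ℝ) :
    c ⬝ᵥ (lam w d q p i v).mulVec c = ∑ l, eval (z l)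
      (w i * (((p i).equivFun.symm c : polyDeg n (d i)) : MvPolynomial (Fin n) ℝ) ^ 2) * v l := by
  have h : ∀ l, eval (z l) (((p i).equivFun.symm c : polyDeg n (d i)) : MvPolynomial (Fin n) ℝ)
      = ∑ k, c k * eval (z l) (p i k : MvPolynomial (Fin n) ℝ) := by
    intro l
    rw [Module.Basis.equivFun_symm_apply]
    simp [smul_eval]
  have h2 : ∀ l, (∑ k, c k * eval (z l) (p i k : MvPolynomial (Fin n) ℝ)) ^ 2 =
      ∑ j, ∑ k, c j * c k * (eval (z l) (p i j : MvPolynomial (Fin n) ℝ) *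
        eval (z l) (p i k : MvPolynomial (Fin n) ℝ)) := by
    intro l
    rw [sq, Finset.sum_mul_sum]
    exact Finset.sum_congr rfl fun j _ => Finset.sum_congr rfl fun k _ => by ring
  simp only [map_mul, map_pow, h, h2, dotProduct, Matrix.mulVec, lam_apply hq, Finset.mul_sum,
    Finset.sum_mul]
  rw [Finset.sum_comm (s := (Finset.univ : Finset (Fin U)))]
  refine Finset.sum_congr rfl fun j _ => ?_
  rw [Finset.sum_comm (s := (Finset.univ : Finset (Fin U)))]
  refine Finset.sum_congr rfl fun k _ => Finset.sum_congr rfl fun l _ => ?_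
  ring

theorem lamLinear_dotProduct_mulVec (v : Fin U → ℝ) (c : (i : Fin m) × Fin (L i) → ℝ) :
    c ⬝ᵥ (lamLinear w d q p v).mulVec c =
      ∑ i, (fun k => c ⟨i, k⟩) ⬝ᵥ (lam w d q p i v).mulVec fun k => c ⟨i, k⟩ := by
  rw [lamLinear_apply, dotProduct, Fintype.sum_sigma]
  refine Finset.sum_congr rfl fun i _ => Finset.sum_congr rfl fun k _ => ?_
  congr 1
  rw [Matrix.mulVec, dotProduct, Fintype.sum_sigma, Finset.sum_eq_single i]
  · simp [Matrix.mulVec, dotProduct, Matrix.blockDiagonal'_apply_eq]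
  · intro j _ hj
    exact Finset.sum_eq_zero fun k' _ => by rw [Matrix.blockDiagonal'_apply_ne _ _ _ hj.symm, zero_mul]
  · simp

/-- The dual cone is the spectrahedral cone defined by `Λ`. -/
theorem mem_dualCone_iff
    (hq : ∀ i j, eval (z j) (q i : MvPolynomial (Fin n) ℝ) = if i = j then 1 else 0)
    {v : Fin U → ℝ} :
    v ∈ dualCone (cone w d q) ↔ (lamLinear w d q p v).PosSemidef := by
  constructor
  · intro hv
    refine .of_dotProduct_mulVec_nonneg (isHermitian_of_isSymm (lamLinear_isSymm v)) fun c => ?_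
    rw [star_trivial, lamLinear_dotProduct_mulVec]
    refine Finset.sum_nonneg fun i _ => ?_
    rw [lam_dotProduct_mulVec hq]
    exact hv _ (eval_mem_cone hq (mul_sq_mem_wsosPolys i (Subtype.prop _)))
  · intro hv s hs
    have hlam : ∀ i, (lam w d q p i v).PosSemidef := by
      intro i
      have h := hv.submatrix (Sigma.mk i)
      convert h using 1
      ext j k
      simp [lamLinear_apply, Matrix.blockDiagonal'_apply_eq]
    obtain ⟨σ, hσ, hsum⟩ := hs
    have hval : ∀ l, s l = ∑ i, eval (z l) (w i * σ i) := fun l => by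
      rw [← eval_toPoly hq s l, hsum, map_sum]
    simp only [dotProduct, hval, Finset.sum_mul]
    rw [Finset.sum_comm]
    refine Finset.sum_nonneg fun i _ => ?_
    obtain ⟨r, g, hg, hσi⟩ := hσ i
    simp only [hσi, Finset.mul_sum, map_sum, Finset.sum_mul]
    rw [Finset.sum_comm]
    refine Finset.sum_nonneg fun j _ => ?_
    have h := (hlam i).dotProduct_mulVec_nonneg ((p i).equivFun ⟨g j, hg j⟩)
    rw [star_trivial, lam_dotProduct_mulVec hq] at h
    simpa using h

/-- The node values are nonnegative, and they are the coordinates of $f$, so they cannot all vanish.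
-/
theorem sum_eval_pos
    (hq : ∀ i j, eval (z j) (q i : MvPolynomial (Fin n) ℝ) = if i = j then 1 else 0)
    (hz : ∀ i, z i ∈ semialgSet w) {f : MvPolynomial (Fin n) ℝ} (hf : f ∈ wsosPolys w d)
    (hf0 : f ≠ 0) : 0 < ∑ l, eval (z l) f := by
  have hnn : ∀ l, 0 ≤ eval (z l) f := fun l => eval_nonneg_of_mem_wsosPolys hf (hz l)
  obtain ⟨s, rfl⟩ : ∃ s, toPoly q s = f := ⟨_, toPoly_eval hq (wsosPolys_subset_wSpace hf)⟩
  simp only [eval_toPoly hq] at hnn ⊢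
  refine Finset.sum_pos' (fun l _ => hnn l) ?_
  by_contra! hcon
  refine hf0 (Finset.sum_eq_zero fun l _ => ?_)
  rw [le_antisymm (hcon l (Finset.mem_univ l)) (hnn l), zero_smul]

/-- The quadratic form at $\mathbf 1$ sums the node values of polynomials $w_ig^2$. This supplies
the strictly feasible point for the determinant maximization. -/
theorem lamLinear_ones_posDef (hw : ∀ i, w i ≠ 0)
    (hq : ∀ i j, eval (z j) (q i : MvPolynomial (Fin n) ℝ) = if i = j then 1 else 0)
    (hz : ∀ i, z i ∈ semialgSet w) :
    (lamLinear w d q p (ones U)).PosDef := by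
  refine .of_dotProduct_mulVec_pos (isHermitian_of_isSymm (lamLinear_isSymm _)) fun c hc => ?_
  rw [star_trivial, lamLinear_dotProduct_mulVec]
  have hval : ∀ i, (fun k => c ⟨i, k⟩) ⬝ᵥ (lam w d q p i (ones U)).mulVec (fun k => c ⟨i, k⟩) =
      ∑ l, eval (z l) (w i * (((p i).equivFun.symm fun k => c ⟨i, k⟩ : polyDeg n (d i)) :
        MvPolynomial (Fin n) ℝ) ^ 2) := fun i => by
    rw [lam_dotProduct_mulVec hq]
    exact Finset.sum_congr rfl fun l _ => mul_one _
  obtain ⟨⟨i, k⟩, hik⟩ := Function.ne_iff.1 hc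
  refine Finset.sum_pos' (fun i _ => ?_) ⟨i, Finset.mem_univ _, ?_⟩
  · rw [hval]
    exact Finset.sum_nonneg fun l _ =>
      eval_nonneg_of_mem_wsosPolys (mul_sq_mem_wsosPolys i (Subtype.prop _)) (hz l)
  · rw [hval]
    refine sum_eval_pos hq hz (mul_sq_mem_wsosPolys i (Subtype.prop _))
      (mul_ne_zero (hw i) (pow_ne_zero 2 fun h0 => hik ?_))
    exact congrFun ((LinearEquiv.map_eq_zero_iff _).1 (Subtype.ext h0)) k

/-- Both $v$ and $-v$ lie in $\Sigma^*$, so $|v_i|$ is at most $\pm\mu\,\mathbf 1^Tv$ for both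
signs. Injectivity of $\Lambda$ makes the Hessian invertible. -/
theorem eq_zero_of_lamLinear_eq_zero
    (hq : ∀ i j, eval (z j) (q i : MvPolynomial (Fin n) ℝ) = if i = j then 1 else 0) {μ : ℝ}
    (hp : ∀ i, C μ + (q i : MvPolynomial (Fin n) ℝ) ∈ wsosPolys w d)
    (hn : ∀ i, C μ - (q i : MvPolynomial (Fin n) ℝ) ∈ wsosPolys w d)
    {v : Fin U → ℝ} (hv : lamLinear w d q p v = 0) : v = 0 := by
  have h1 : v ∈ dualCone (cone w d q) := by
    rw [mem_dualCone_iff (p := p) hq, hv]; exact Matrix.PosSemidef.zero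
  have h2 : -v ∈ dualCone (cone w d q) := by
    rw [mem_dualCone_iff (p := p) hq, map_neg, hv, neg_zero]; exact Matrix.PosSemidef.zero
  ext i
  have h3 := abs_apply_le_of_mem_dualCone hq hp hn h1 i
  have h4 := abs_apply_le_of_mem_dualCone hq hp hn h2 i
  rw [Pi.neg_apply, abs_neg, dotProduct_neg] at h4
  have h5 : |v i| ≤ 0 := by linarith
  simpa using h5

theorem mem_interior_dualCone
    (hq : ∀ i j, eval (z j) (q i : MvPolynomial (Fin n) ℝ) = if i = j then 1 else 0)
    {x : Fin U → ℝ} (hx : (lamLinear w d q p x).PosDef) :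
    x ∈ interior (dualCone (cone w d q)) := by
  rw [mem_interior_iff_mem_nhds]
  have hc : Continuous fun y => localInner (lamLinear w d q p x)
      (lamLinear w d q p y - lamLinear w d q p x) (lamLinear w d q p y - lamLinear w d q p x) := by
    have := continuous_linearMap_matrix (lamLinear w d q p)
    unfold localInner
    fun_prop
  have hev := hc.continuousAt.eventually_lt (x₀ := x) (g := fun _ => (1 : ℝ)) continuousAt_const
    (by simp [localInner])
  filter_upwards [hev] with y hy
  rw [mem_dualCone_iff (p := p) hq]
  exact (posDef_of_localInner_sub_lt_one hx (lamLinear_isSymm y) hy).posSemidef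

/-- Vectors close to a multiple of the gradient certificate of `t` are certificates of `t`. -/
theorem isDualCertificate_of_sum_lt
    (hq : ∀ i j, eval (z j) (q i : MvPolynomial (Fin n) ℝ) = if i = j then 1 else 0)
    (hz : ∀ i, z i ∈ semialgSet w) {μ : ℝ}
    (hp : ∀ i, C μ + (q i : MvPolynomial (Fin n) ℝ) ∈ wsosPolys w d)
    (hn : ∀ i, C μ - (q i : MvPolynomial (Fin n) ℝ) ∈ wsosPolys w d)
    {t x y : Fin U → ℝ} {k : ℝ} (hk : 0 < k) (htc : t ∈ cone w d q)
    (hx : (lamLinear w d q p x).PosDef)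
    (ht : ∀ v, ((lamLinear w d q p x)⁻¹ * lamLinear w d q p v).trace = t ⬝ᵥ v)
    (hxy : ∑ a, |y a - k * x a| * t a < k) :
    IsDualCertificate w d q p t y := by
  have htnn : ∀ a, 0 ≤ t a := fun a => by
    simpa using single_mem_dualCone hq hz a t htc
  have hE : ∀ a, (lamLinear w d q p (Pi.single a 1)).PosSemidef := fun a =>
    (mem_dualCone_iff hq).1 (single_mem_dualCone hq hz a)
  have hx' : (lamLinear w d q p (k • x)).PosDef := by rw [map_smul]; exact hx.smul hk
  -- The gradient is homogeneous of degree $-1$: the point $kx$ belongs to $t/k$.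
  have ht' : ∀ v, ((lamLinear w d q p (k • x))⁻¹ * lamLinear w d q p v).trace
      = (k⁻¹ • t) ⬝ᵥ v := by
    intro v
    have : Invertible k := invertibleOfNonzero hk.ne'
    rw [map_smul, Matrix.inv_smul _ k ((Matrix.isUnit_iff_isUnit_det _).1 hx.isUnit), invOf_eq_inv,
      smul_mul_assoc, Matrix.trace_smul, ht, smul_dotProduct]
  have hle := localInner_self_le_sq_sum hx' ht' hE (y - k • x)
  have hs0 : 0 ≤ ∑ a, |y a - k * x a| * t a :=
    Finset.sum_nonneg fun a _ => mul_nonneg (abs_nonneg _) (htnn a)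
  have hlt : localInner (lamLinear w d q p (k • x))
      (lamLinear w d q p y - lamLinear w d q p (k • x))
      (lamLinear w d q p y - lamLinear w d q p (k • x)) < 1 := by
    rw [← map_sub]
    refine hle.trans_lt ?_
    have he : ∑ a, |(y - k • x) a| * (k⁻¹ • t) a = (∑ a, |y a - k * x a| * t a) / k := by
      rw [Finset.sum_div]
      refine Finset.sum_congr rfl fun a _ => ?_
      simp only [Pi.sub_apply, Pi.smul_apply, smul_eq_mul]
      ring
    rw [he]
    exact pow_lt_one₀ (by positivity) ((div_lt_one hk).2 hxy) two_ne_zero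
  have hy := posDef_of_localInner_sub_lt_one hx' (lamLinear_isSymm y) hlt
  have hH : hessian (barrier w d q p) y = gramMatrix (lamLinear w d q p) (lamLinear w d q p y) := by
    ext a b
    exact hessian_neg_log_det (lamLinear w d q p) hy.det_pos.ne' a b
  have hmain := posSemidef_gramMatrix_inv_mulVec lamLinear_isSymm
    (fun v hv => eq_zero_of_lamLinear_eq_zero hq hp hn hv) hx' hy ht' hlt.le
  refine ⟨htc, mem_interior_dualCone hq hy, ?_⟩
  -- Multiplying $H(y)^{-1}(t/k)\in\Sigma^*$ by $k$ undoes the scaling.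
  have h := smul_mem_dualCone hk.le ((mem_dualCone_iff hq).2 hmain)
  rwa [Matrix.mulVec_smul, smul_smul, mul_inv_cancel₀ hk.ne', one_smul, ← hH] at h

end Lambda

/-! ### Size estimates for rounded vectors -/

section Rounding

variable {U : ℕ}

theorem norm_le_half_add_mul {y x : Fin U → ℝ} {k b : ℝ} (hk : 0 ≤ k) (hb : ‖x‖ ≤ b)
    (h : ∀ a, |y a - k * x a| ≤ 1 / 2) : ‖y‖ ≤ 1 / 2 + k * b := by
  have hb0 : 0 ≤ b := (norm_nonneg x).trans hb
  refine (pi_norm_le_iff_of_nonneg (by positivity)).2 fun a => ?_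
  have h1 : |x a| ≤ b := (norm_le_pi_norm x a).trans hb
  have h2 : |k * x a| ≤ k * b := by
    rw [abs_mul, abs_of_nonneg hk]; exact mul_le_mul_of_nonneg_left h1 hk
  calc ‖y a‖ = |(y a - k * x a) + k * x a| := by rw [Real.norm_eq_abs]; ring_nf
    _ ≤ |y a - k * x a| + |k * x a| := abs_add_le _ _
    _ ≤ 1 / 2 + k * b := add_le_add (h a) h2

/-- An integer vector of size at most `1/2 + (3/2) √U N μ ν / ε` has logarithmic size. -/
theorem log_le_of_le {B N μ ν ε u : ℝ} (hB0 : 0 ≤ B) (hu : 2 ≤ u) (hμ : 1 ≤ μ) (hν : 1 ≤ ν)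
    (hε : 0 < ε) (hN : ε ≤ N) (hB : B ≤ 1 / 2 + 3 / 2 * √u * N * (μ * ν / ε)) :
    Real.log B ≤
      2 * (Real.log u + Real.log N + Real.log μ + Real.log ν + Real.log (1 / ε)) := by
  have hN0 : 0 < N := hε.trans_le hN
  set R := u * N * μ * ν * (1 / ε) with hR
  have hlogR : Real.log R =
      Real.log u + Real.log N + Real.log μ + Real.log ν + Real.log (1 / ε) := by
    rw [hR, Real.log_mul (by positivity) (by positivity), Real.log_mul (by positivity)
      (by positivity), Real.log_mul (by positivity) (by positivity),
      Real.log_mul (by positivity) (by positivity)]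
  have hRu : u ≤ R := by
    have h1 : 1 ≤ N * (1 / ε) := by rw [mul_one_div, le_div_iff₀ hε]; linarith
    have h2 : 1 ≤ μ * ν := one_le_mul_of_one_le_of_one_le hμ hν
    have h3 : 1 ≤ (N * (1 / ε)) * (μ * ν) := one_le_mul_of_one_le_of_one_le h1 h2
    calc u ≤ u * ((N * (1 / ε)) * (μ * ν)) := le_mul_of_one_le_right (by linarith) h3
      _ = R := by rw [hR]; ring
  have hsqrt : √u ≤ u := by
    rw [Real.sqrt_le_left (by linarith)]
    nlinarith
  -- Since $R\ge u\ge2$, $\frac12+\frac32R\le R^2$; the square is the source of the factor $2$.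
  have hBR : B ≤ R * R := by
    have h1 : 3 / 2 * √u * N * (μ * ν / ε) ≤ 3 / 2 * R := by
      calc 3 / 2 * √u * N * (μ * ν / ε) ≤ 3 / 2 * u * N * (μ * ν / ε) := by gcongr
        _ = 3 / 2 * R := by rw [hR]; ring
    nlinarith
  rw [← hlogR]
  rcases hB0.eq_or_lt with h0 | h0
  -- For $B=0$ the convention $\log 0=0$ applies.
  · rw [← h0, Real.log_zero]
    exact mul_nonneg zero_le_two (Real.log_nonneg (by linarith))
  · calc Real.log B ≤ Real.log (R * R) := Real.log_le_log h0 hBR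
      _ = 2 * Real.log R := by rw [Real.log_mul (by linarith) (by linarith)]; ring

theorem log_sum_nonneg {N μ ν ε u : ℝ} (hu : 1 ≤ u) (hμ : 1 ≤ μ) (hν : 1 ≤ ν)
    (hε : 0 < ε) (hN : ε ≤ N) :
    0 ≤ Real.log u + Real.log N + Real.log μ + Real.log ν + Real.log (1 / ε) := by
  have h1 := Real.log_le_log hε hN
  rw [one_div, Real.log_inv]
  have h2 := Real.log_nonneg hu
  have h3 := Real.log_nonneg hμ
  have h4 := Real.log_nonneg hν
  linarith

end Rounding

/-! ### Gradient and integer certificates of $t$ -/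

section Certificates

variable {n m U : ℕ} {w : Fin m → MvPolynomial (Fin n) ℝ} {d : Fin m → ℕ}
  {q : Module.Basis (Fin U) ℝ (wSpace w d)} {L : Fin m → ℕ}
  {p : (i : Fin m) → Module.Basis (Fin (L i)) ℝ (polyDeg n (d i))} {z : Fin U → Fin n → ℝ}

theorem pos_of_basis_polyDeg {k l : ℕ} (b : Module.Basis (Fin l) ℝ (polyDeg n k)) : 0 < l := by
  rcases Nat.eq_zero_or_pos l with rfl | h
  · exfalso
    have : Subsingleton (polyDeg n k) := b.repr.toEquiv.subsingleton
    have h0 := congrArg Subtype.val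
      (Subsingleton.elim (⟨1, one_mem_polyDeg k⟩ : polyDeg n k) 0)
    exact one_ne_zero h0
  · exact h

/-- The gradient certificate of an interior point of the cone, with its size. -/
theorem exists_gradientCertificate (hm : 0 < m) (hw : ∀ i, w i ≠ 0)
    (hq : ∀ i j, eval (z j) (q i : MvPolynomial (Fin n) ℝ) = if i = j then 1 else 0)
    (hz : ∀ i, z i ∈ semialgSet w) {μ : ℝ} (hμ : 0 < μ)
    (hp : ∀ i, C μ + (q i : MvPolynomial (Fin n) ℝ) ∈ wsosPolys w d)
    (hn : ∀ i, C μ - (q i : MvPolynomial (Fin n) ℝ) ∈ wsosPolys w d)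
    {t : Fin U → ℝ} {ε : ℝ} (ht : t ∈ interior (cone w d q)) (hε : 0 < ε)
    (htε : t - ε • ones U ∈ frontier (cone w d q)) :
    ∃ x, (lamLinear w d q p x).PosDef ∧
      (∀ v, ((lamLinear w d q p x)⁻¹ * lamLinear w d q p v).trace = t ⬝ᵥ v) ∧
      ‖x‖ ≤ μ * ((∑ i, L i : ℕ) : ℝ) / ε := by
  have : Nonempty ((i : Fin m) × Fin (L i)) :=
    ⟨⟨⟨0, hm⟩, ⟨0, pos_of_basis_polyDeg (p ⟨0, hm⟩)⟩⟩⟩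
  obtain ⟨c, hc, hct⟩ := exists_pos_mul_norm_le ht
  obtain ⟨x, hx, hxt⟩ := exists_gradient_eq (Λ := lamLinear w d q p) lamLinear_isSymm hc
    (fun v hv => hct v ((mem_dualCone_iff hq).2 hv)) (lamLinear_ones_posDef hw hq hz)
  refine ⟨x, hx, hxt, ?_⟩
  have hxd : x ∈ dualCone (cone w d q) := (mem_dualCone_iff hq).2 hx.posSemidef
  -- Taking $v=x$ in the gradient identity gives $\mathrm{tr}\,1=\nu$.
  have htx : t ⬝ᵥ x = ((∑ i, L i : ℕ) : ℝ) := by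
    rw [← hxt, Matrix.nonsing_inv_mul _ ((Matrix.isUnit_iff_isUnit_det _).1 hx.isUnit),
      Matrix.trace_one]
    simp
  have h1 := dotProduct_nonneg_of_mem_closure (frontier_subset_closure htε) hxd
  rw [sub_dotProduct, smul_dotProduct, smul_eq_mul, htx] at h1
  have h2 : ones U ⬝ᵥ x ≤ ((∑ i, L i : ℕ) : ℝ) / ε := by
    rw [le_div_iff₀ hε]; linarith
  refine (pi_norm_le_iff_of_nonneg (by positivity)).2 fun a => ?_
  rw [Real.norm_eq_abs, mul_div_assoc]
  exact (abs_apply_le_of_mem_dualCone hq hp hn hxd a).trans (mul_le_mul_of_nonneg_left h2 hμ.le)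

theorem exists_integer_certificate (hm : 0 < m) (hw : ∀ i, w i ≠ 0)
    (hq : ∀ i j, eval (z j) (q i : MvPolynomial (Fin n) ℝ) = if i = j then 1 else 0)
    (hz : ∀ i, z i ∈ semialgSet w) {μ : ℝ} (hμ : 0 < μ)
    (hp : ∀ i, C μ + (q i : MvPolynomial (Fin n) ℝ) ∈ wsosPolys w d)
    (hn : ∀ i, C μ - (q i : MvPolynomial (Fin n) ℝ) ∈ wsosPolys w d)
    {t : Fin U → ℝ} {ε : ℝ} (ht : t ∈ interior (cone w d q)) (hε : 0 < ε)
    (htε : t - ε • ones U ∈ frontier (cone w d q)) :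
    ∃ y : Fin U → ℤ,
      IsDualCertificate w d q p t (fun l => (y l : ℝ)) ∧
      ‖(fun l => (y l : ℝ) : Fin U → ℝ)‖ ≤
        1 / 2 + (⌈3 / 2 * √(U : ℝ) * norm2 t⌉ : ℝ) * (μ * ((∑ i, L i : ℕ) : ℝ) / ε) ∧
      Real.log ‖(fun l => (y l : ℝ) : Fin U → ℝ)‖ ≤
        2 * (Real.log U + Real.log (norm2 t) + Real.log μ +
          Real.log ((∑ i, L i : ℕ) : ℝ) + Real.log (1 / ε)) := by
  obtain ⟨x, hx, hxt, hxn⟩ := exists_gradientCertificate (p := p) hm hw hq hz hμ hp hn ht hε htε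
  have htc := interior_subset ht
  have hU := pos_of_basis_wSpace hm hw q
  let a₀ : Fin U := ⟨0, hU⟩
  have hμ1 : 1 ≤ μ := one_le_of_mem_wsosPolys hq hz a₀ (hn a₀)
  have hν1 : (1 : ℝ) ≤ ((∑ i, L i : ℕ) : ℝ) := by
    have h1 : L ⟨0, hm⟩ ≤ ∑ i, L i :=
      Finset.single_le_sum (f := L) (fun i _ => Nat.zero_le _) (Finset.mem_univ _)
    exact_mod_cast (pos_of_basis_polyDeg (p ⟨0, hm⟩)).trans_le h1
  have hta : ∀ a, ε ≤ t a := fun a => by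
    have h := dotProduct_nonneg_of_mem_closure (frontier_subset_closure htε)
      (single_mem_dualCone hq hz a)
    simp only [dotProduct_single, Pi.sub_apply, Pi.smul_apply, ones, smul_eq_mul, mul_one] at h
    linarith
  have hN : ε ≤ norm2 t := (hta a₀).trans ((le_abs_self _).trans (abs_apply_le_norm2 t a₀))
  have hN0 : 0 < norm2 t := hε.trans_le hN
  set ν : ℝ := ((∑ i, L i : ℕ) : ℝ)
  -- `log_le_of_le` needs $U\ge2$ to absorb its numerical constants. For $U=1$ the integer $1$ is a
  -- positive multiple of $x$, hence a certificate.
  rcases (Nat.succ_le_of_lt hU).eq_or_lt with h1 | h2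
  · obtain rfl : U = 1 := h1.symm
    have hx0 : 0 < x 0 := by
      have hxd : x ∈ dualCone (cone w d q) := (mem_dualCone_iff hq).2 hx.posSemidef
      have h := hxd t htc
      have hne : x 0 ≠ 0 := by
        intro h0
        have hx0 : x = 0 := funext fun a => by rw [Subsingleton.elim a 0, h0]; rfl
        rw [hx0, map_zero] at hx
        have : Nonempty ((i : Fin m) × Fin (L i)) :=
          ⟨⟨⟨0, hm⟩, ⟨0, pos_of_basis_polyDeg (p ⟨0, hm⟩)⟩⟩⟩
        have htr := hx.trace_pos
        simp at htr
      have h3 : 0 ≤ x 0 := by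
        have := abs_apply_le_of_mem_dualCone hq hp hn hxd 0
        simp only [dotProduct, ones, Finset.univ_unique, Finset.sum_singleton, one_mul,
          Fin.default_eq_zero, Fin.isValue] at this
        exact nonneg_of_mul_nonneg_right ((abs_nonneg _).trans this) hμ
      exact lt_of_le_of_ne h3 hne.symm
    refine ⟨fun _ => 1, ?_, ?_, ?_⟩
    -- With $k=1/x_0$ the point $kx$ is exactly $1$, and the error is zero.
    · refine isDualCertificate_of_sum_lt hq hz hp hn (inv_pos.2 hx0) htc hx hxt ?_
      simp [hx0.ne', hx0]
    · have hn1 : ‖(fun _ => ((1 : ℤ) : ℝ) : Fin 1 → ℝ)‖ = 1 := by simp [Pi.norm_def]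
      rw [hn1]
      have hce : 3 / 2 * ε ≤ (⌈3 / 2 * √((1 : ℕ) : ℝ) * norm2 t⌉ : ℝ) := by
        refine le_trans ?_ (Int.le_ceil _)
        simpa using hN
      have : 3 / 2 ≤ (⌈3 / 2 * √((1 : ℕ) : ℝ) * norm2 t⌉ : ℝ) * (μ * ν / ε) := by
        calc (3 : ℝ) / 2 = 3 / 2 * ε * (1 * 1 / ε) := by field_simp
          _ ≤ _ := by gcongr
      linarith
    · have hn1 : ‖(fun _ => ((1 : ℤ) : ℝ) : Fin 1 → ℝ)‖ = 1 := by simp [Pi.norm_def]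
      rw [hn1, Real.log_one]
      exact mul_nonneg zero_le_two (log_sum_nonneg (by simp) hμ1 hν1 hε hN)
  · have hU2 : (2 : ℝ) ≤ U := by exact_mod_cast h2
    -- The rounding error costs at most $\frac12\sum_a t_a\le\frac12\sqrt U\|t\|_2<k$. No ceiling is
    -- needed here; it only weakens the final bound.
    set k : ℝ := 3 / 2 * √(U : ℝ) * norm2 t with hk
    have hk0 : 0 < k := by positivity
    have hround : ∀ a, |((round (k * x a) : ℤ) : ℝ) - k * x a| ≤ 1 / 2 := fun a => by
      rw [abs_sub_comm]; exact abs_sub_round _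
    have hbound := norm_le_half_add_mul (y := fun a => ((round (k * x a) : ℤ) : ℝ))
      hk0.le hxn hround
    refine ⟨fun a => round (k * x a), ?_, ?_, ?_⟩
    · refine isDualCertificate_of_sum_lt hq hz hp hn hk0 htc hx hxt ?_
      have hsum := sum_le_sqrt_mul_norm2 t
      calc ∑ a, |((round (k * x a) : ℤ) : ℝ) - k * x a| * t a ≤ ∑ a, 1 / 2 * t a :=
            Finset.sum_le_sum fun a _ =>
              mul_le_mul_of_nonneg_right (hround a) (hε.le.trans (hta a))
        _ = 1 / 2 * ∑ a, t a := by rw [Finset.mul_sum]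
        _ ≤ 1 / 2 * (√(U : ℝ) * norm2 t) := by gcongr
        _ < k := by
          have : 0 < √(U : ℝ) * norm2 t := by positivity
          rw [hk]; linarith
    · refine hbound.trans ?_
      gcongr
      exact Int.le_ceil _
    · exact log_le_of_le (norm_nonneg _) hU2 hμ1 hν1 hε hN hbound

end Certificates

end WSOS

theorem mainTheorem10 :
    ∃ C : ℝ, 0 < C ∧
    ∀ (n m : ℕ) (_ : 0 < m)
      (w : Fin m → MvPolynomial (Fin n) ℝ) (_ : ∀ i, w i ≠ 0) (d : Fin m → ℕ)
      (_ : Bornology.IsBounded (WSOS.semialgSet w))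
      (U : ℕ) (q : Module.Basis (Fin U) ℝ (WSOS.wSpace w d))
      (L : Fin m → ℕ)
      (p : (i : Fin m) → Module.Basis (Fin (L i)) ℝ (WSOS.polyDeg n (d i)))
      (z : Fin U → Fin n → ℝ) (_ : ∀ i, z i ∈ WSOS.semialgSet w)
      (_ : WSOS.IsUnisolvent (WSOS.wSpace w d) (Set.range z))
      (_ : ∀ i j, MvPolynomial.eval (z j) (q i : MvPolynomial (Fin n) ℝ) = if i = j then 1 else 0)
      (μ : ℝ) (_ : 0 < μ)
      (_ : ∀ i, MvPolynomial.C μ + (q i : MvPolynomial (Fin n) ℝ) ∈ WSOS.wsosPolys w d)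
      (_ : ∀ i, MvPolynomial.C μ - (q i : MvPolynomial (Fin n) ℝ) ∈ WSOS.wsosPolys w d),
      -- the all-ones vector represents the constant polynomial one
      WSOS.toPoly q (WSOS.ones U) = 1 ∧
      -- first claim (the minimum defining `kOne` is attained)
      (IsLeast (WSOS.kOneSet (WSOS.cone w d q) (WSOS.ones U))
          (WSOS.kOne (WSOS.cone w d q) (WSOS.ones U)) ∧
        1 / μ ≤ WSOS.kOne (WSOS.cone w d q) (WSOS.ones U)) ∧
      -- second claim
      (WSOS.IsNodeMatrix w d q 1 ∧ WSOS.cond (1 : Matrix (Fin U) (Fin U) ℝ) = 1) ∧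
      -- third claim
      (∀ (t : Fin U → ℝ) (ε : ℝ), t ∈ interior (WSOS.cone w d q) → 0 < ε →
        t - ε • WSOS.ones U ∈ frontier (WSOS.cone w d q) →
        ∃ y : Fin U → ℤ,
          WSOS.IsDualCertificate w d q p t (fun l => (y l : ℝ)) ∧
          ‖(fun l => (y l : ℝ) : Fin U → ℝ)‖ ≤
            1 / 2 + (⌈3 / 2 * √(U : ℝ) * WSOS.norm2 t⌉ : ℝ) *
              (μ * ((∑ i, L i : ℕ) : ℝ) / ε) ∧
          Real.log ‖(fun l => (y l : ℝ) : Fin U → ℝ)‖ ≤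
            C * (Real.log U + Real.log (WSOS.norm2 t) + Real.log μ +
              Real.log ((∑ i, L i : ℕ) : ℝ) + Real.log (1 / ε))) := by
  refine ⟨2, zero_lt_two, ?_⟩
  intro n m hm w hw d _ U q L p z hz hu hq μ hμ hp hn
  have hU := WSOS.pos_of_basis_wSpace hm hw q
  let a₀ : Fin U := ⟨0, hU⟩
  have hleast := WSOS.isLeast_kOne (WSOS.ones U)
    ⟨_, WSOS.single_mem_dualCone hq hz a₀, by rw [Pi.norm_single, norm_one]⟩
  refine ⟨WSOS.toPoly_ones hq (WSOS.one_mem_wSpace hμ (hp a₀) (hn a₀)), ⟨hleast, ?_⟩,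
    ⟨WSOS.isNodeMatrix_one hq hz hu, WSOS.cond_one hU⟩, fun t ε ht hε htε =>
      WSOS.exists_integer_certificate hm hw hq hz hμ hp hn ht hε htε⟩
  -- A minimizer $v$ satisfies $1=\|v\|_\infty\le\mu\,\mathbf 1^Tv=\mu k_1^{\mathbf 1}$.
  obtain ⟨v, hv, hv1, hk⟩ := hleast.1
  rw [hk, div_le_iff₀' hμ, ← hv1]
  have h := WSOS.abs_apply_le_of_mem_dualCone hq hp hn hv
  exact (pi_norm_le_iff_of_nonneg ((abs_nonneg _).trans (h a₀))).2 h
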